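/- **Theorem 3.2.** Let $\mathbb N=\{1,2,3,\dots\}$. *The tree.* Take four copies, indexed by the intervals $(-\infty,-1)$, $(-1,0)$, $(0,1)$, $(1,\infty)$, of the tree whose vertices are the finite sequences $(s_1,\dots,s_k)$, $k\ge 0$, of elements of $\mathbb N$ and whose edges are $(s_1,\dots,s_{k-1})-(s_1,\dots,s_{k-1},s_k)$. Join the four initial points (empty sequences) by three edges so that one tree $\mathbb T$ results (the choice of the three edges is arbitrary). All vertices of $\mathbb T$ have countably infinite valence. A *way* is a sequence $a_0,a_1,a_2,\dots$ of distinct vertices with $a_n$ adjacent to $a_{n+1}$; the boundary $\partial\mathbb T$ is the set of ways, where $a$ and $b$ are identified if there are $m,n\ge 0$ with $a_{m+j}=b_{n+j}$ for all $j\ge0$. *The map $\Xi$.* For irrational $x$ let $|x|=[u_0;u_1,u_2,\dots]$ be the continued fraction expansion, and put $(s_1,s_2,\dots)=(u_0,u_1,\dots)$ if $|x|>1$ and $(s_1,s_2,\dots)=(u_1,u_2,\dots)$ if $|x|<1$. Then $\Xi(x)\in\partial\mathbb T$ is the class of the way $\varnothing,(s_1),(s_1,s_2),\dots$ in the copy indexed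 by the interval containing $x$. *Spheromorphisms.* A $(\mathbb T)$-subtree is a proper subtree of $\mathbb T$ isomorphic to $\mathbb T$ and joined to its complement by only finitely many edges. A $(\mathbb T)$-covering forest is a finite collection of pairwise disjoint $(\mathbb T)$-subtrees containing together all vertices and all but finitely many edges of $\mathbb T$. A bijection of $\partial\mathbb T$ is a spheromorphism, i.e. lies in $\mathrm{Hier}(\mathbb T)$, if there are covering forests $S_1,\dots,S_k$ and $R_1,\dots,R_k$ and isomorphisms of trees $g_j:S_j\to R_j$ such that it sends the class of each way $(a_n)$ lying in $S_j$ to the class of $(g_j(a_n))$. *The Thompson group.* $\mathrm{Th}$ is the group of homeomorphisms $h$ of $\mathbb{RP}^1=\mathbb R\cup\{\infty\}$ for which there is a finite set $F\subset\mathbb Q\cup\{\infty\}$ such that on each connected subset of $\mathbb{RP}^1\setminus F$ the map $h$ coincides with an element of $\mathrm{PSL}_2(\mathbb Z)$ acting by linear fractional transformations. *Claim.* The map $\Xi:\mathbb R\setminus\mathbb Q\to\partial\mathbb T$ is a bijection. Every $h\in\mathrm{Th}$ restricts to a bijection $\varkappa$ of $\mathbb R\setminus\mathbb Q$, and $\Xi\circ\varkappa\circ\Xi^{-1}\in\mathrm{Hier}(\mathbb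 T)$. The same holds for every linear fractional transformation $h\in\mathrm{PGL}_2(\mathbb Z)$. -/

import Mathlib

open scoped MatrixGroups

namespace Spheromorphism

/-! ### Ends of a tree -/

/-- A way in a graph: a sequence of pairwise distinct vertices `a 0, a 1, a 2, …` in which
consecutive vertices are joined by an edge. -/
structure Way {V : Type*} (G : SimpleGraph V) where
  /-- The vertices of the way. -/
  toFun : ℕ → V
  injective : Function.Injective toFun
  adj : ∀ n, G.Adj (toFun n) (toFun (n + 1))

/-- The image of a way under an embedding of graphs. -/
def Way.map {V W : Type*} {G : SimpleGraph V} {H : SimpleGraph W} (f : G ↪g H) (a : Way G) :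
    Way H where
  toFun n := f (a.toFun n)
  injective := f.injective.comp a.injective
  adj n := f.map_adj_iff.2 (a.adj n)

/-- Two ways are equivalent if they coincide eventually up to a shift of the numbering. -/
instance waySetoid {V : Type*} (G : SimpleGraph V) : Setoid (Way G) where
  r a b := ∃ m n : ℕ, ∀ j : ℕ, a.toFun (m + j) = b.toFun (n + j)
  iseqv :=
    { refl := fun _ => ⟨0, 0, fun _ => rfl⟩
      symm := fun ⟨m, n, h⟩ => ⟨n, m, fun j => (h j).symm⟩
      trans := by
        rintro a b c ⟨m, n, h⟩ ⟨p, q, h'⟩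
        refine ⟨m + p, q + n, fun j => ?_⟩
        have h1 := h (p + j)
        have h2 := h' (n + j)
        rw [show m + p + j = m + (p + j) by omega, h1,
          show n + (p + j) = p + (n + j) by omega, h2,
          show q + (n + j) = q + n + j by omega] }

/-- The boundary of a tree: the set of ways up to equivalence. -/
def Boundary {V : Type*} (G : SimpleGraph V) : Type _ := Quotient (waySetoid G)

/-- The point of the boundary represented by a way. -/
def endOf {V : Type*} {G : SimpleGraph V} (a : Way G) : Boundary G := Quotient.mk (waySetoid G) a

/-! ### Spheromorphisms

In this section `T` is the tree all of whose vertices have countably infinite valence.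
A subtree of `T` is determined by its set of vertices. -/

/-- `S` is the vertex set of a `(T)`-subtree: a proper subtree isomorphic to `T` such that only
finitely many edges of `T` join it to its complement. -/
def IsTSubtree {V : Type*} (T : SimpleGraph V) (S : Set V) : Prop :=
  S ≠ Set.univ ∧ Nonempty (T.induce S ≃g T) ∧
    {e : Sym2 V | ∃ a ∈ S, ∃ b ∉ S, T.Adj a b ∧ e = s(a, b)}.Finite

/-- A `(T)`-covering forest: finitely many disjoint `(T)`-subtrees which together contain all
vertices of `T` and all but finitely many edges of `T`. -/
structure IsCoveringForest {V : Type*} (T : SimpleGraph V) {k : ℕ} (S : Fin k → Set V) :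
    Prop where
  isTSubtree : ∀ j, IsTSubtree T (S j)
  pairwise_disjoint : Pairwise fun i j => Disjoint (S i) (S j)
  iUnion_eq : ⋃ j, S j = Set.univ
  finite_edges : {e ∈ T.edgeSet | ∀ j, ¬ ∀ v ∈ e, v ∈ S j}.Finite

/-- `Hier T`: the spheromorphisms of `T`, regarded as transformations of the boundary of `T`.
A spheromorphism is given by two covering forests `S`, `R` and isomorphisms `g j : S j → R j`; it
sends the end of a way `a` lying in `S j` to the end of the way `g j ∘ a` lying in `R j`.
(Each end of `T` is represented by a way lying in one of the `S j`.) -/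
def Hier {V : Type*} (T : SimpleGraph V) : Set (Equiv.Perm (Boundary T)) :=
  {Φ | ∃ (k : ℕ) (S R : Fin k → Set V) (g : ∀ j, T.induce (S j) ≃g T.induce (R j)),
    IsCoveringForest T S ∧ IsCoveringForest T R ∧
    ∀ (j : Fin k) (a : Way (T.induce (S j))),
      Φ (endOf (a.map (SimpleGraph.Embedding.induce (S j)))) =
        endOf ((a.map (g j).toEmbedding).map (SimpleGraph.Embedding.induce (R j)))}

/-! ### The tree attached to continued fractions -/

/-- The four pieces into which the irrational numbers are cut by `-1`, `0`, `1`. -/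
inductive Piece
  /-- `(-∞, -1)` -/
  | negOuter
  /-- `(-1, 0)` -/
  | negInner
  /-- `(0, 1)` -/
  | posInner
  /-- `(1, ∞)` -/
  | posOuter

/-- The tree `𝕋`. It consists of four copies of the tree whose vertices are the finite sequences
of positive integers and whose edges are `(s₁, …, sₖ) — (s₁, …, sₖ, sₖ₊₁)`, together with edges
which join the initial points (the empty sequences) of the copies according to a graph `C` on the
set of the four copies (three edges, when `C` is a tree). -/
def tree (C : SimpleGraph Piece) : SimpleGraph (Piece × List ℕ+) where
  Adj v w :=
    (v.1 = w.1 ∧ ∃ s : ℕ+, w.2 = v.2 ++ [s] ∨ v.2 = w.2 ++ [s]) ∨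
      (v.2 = [] ∧ w.2 = [] ∧ C.Adj v.1 w.1)
  symm := ⟨by
    rintro v w (⟨h, s, hs⟩ | ⟨hv, hw, h⟩)
    · exact Or.inl ⟨h.symm, s, hs.symm⟩
    · exact Or.inr ⟨hw, hv, h.symm⟩⟩
  loopless := ⟨by
    rintro v (⟨-, s, hs⟩ | ⟨-, -, h⟩)
    · rcases hs with hs | hs <;> simpa using congrArg List.length hs
    · exact C.loopless.irrefl _ h⟩

/-- The `n`-th partial quotient `sₙ` of the continued fraction `x = [s₀; s₁, s₂, …]`. It is used
only where it is a positive integer. -/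
noncomputable def partialQuotient (x : ℝ) (n : ℕ) : ℕ+ :=
  ((GenContFract.IntFractPair.stream x n).elim 0 fun p => p.b.toNat).toPNat'

open Classical in
/-- The piece which contains the irrational number `x`. -/
noncomputable def piece (x : ℝ) : Piece :=
  if x < -1 then .negOuter else if x < 0 then .negInner else if x < 1 then .posInner else .posOuter

/-- The sequence of positive integers attached to an irrational number `x`: it is `s₀, s₁, s₂, …`
if `|x| > 1` and `|x| = [s₀; s₁, s₂, …]`, and it is `s₁, s₂, …` if `|x| < 1` and
`|x| = [0; s₁, s₂, …]`. -/
noncomputable def digits (x : ℝ) (n : ℕ) : ℕ+ :=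
  match piece x with
  | .negOuter | .posOuter => partialQuotient |x| n
  | .negInner | .posInner => partialQuotient |x| (n + 1)

/-- The way in `𝕋` which starts at the initial point of the `p`-th copy and runs through the
initial segments of the sequence `s`. -/
def wayOf (C : SimpleGraph Piece) (p : Piece) (s : ℕ → ℕ+) : Way (tree C) where
  toFun n := (p, (List.range n).map s)
  injective m n h := by simpa using congrArg (fun v : Piece × List ℕ+ => v.2.length) h
  adj n := Or.inl ⟨rfl, s n, Or.inl (by simp [List.range_succ])⟩

/-- The map `Ξ` from the irrational numbers to the boundary of `𝕋`. -/
noncomputable def Xi (C : SimpleGraph Piece) (x : {x : ℝ // Irrational x}) :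
    Boundary (tree C) :=
  endOf (wayOf C (piece x) (digits x))

/-! ### The Thompson group -/

/-- The linear fractional transformation `x ↦ (a x + b) / (c x + d)` of the real projective line
`ℝ ∪ {∞}` defined by an integral matrix of determinant `±1`. -/
noncomputable def linFrac (γ : GL (Fin 2) ℤ) (x : OnePoint ℝ) : OnePoint ℝ :=
  γ.map (Int.castRingHom ℝ) • x

/-- `Th`: the homeomorphisms of the real projective line which are piecewise in `PSL₂(ℤ)`, with
finitely many break points, all of them in `ℚ ∪ {∞}`. That is, there is a finite set `F` of points
of `ℚ ∪ {∞}` such that on each connected set not meeting `F` the transformation coincides with an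
element of `PSL₂(ℤ)`. -/
def thompson : Set (OnePoint ℝ ≃ₜ OnePoint ℝ) :=
  {h | ∃ F : Set (OnePoint ℝ), F.Finite ∧
    (∀ p ∈ F, p = OnePoint.infty ∨ ∃ q : ℚ, p = ((q : ℝ) : OnePoint ℝ)) ∧
    ∀ I : Set (OnePoint ℝ), IsPreconnected I → Disjoint I F →
      ∃ γ : SL(2, ℤ), ∀ x ∈ I, h x = linFrac (γ : GL (Fin 2) ℤ) x}

end Spheromorphism

namespace Spheromorphism

/-! ### Continued fractions of irrational numbers -/

/-! Bijectivity of `Xi` is the classical correspondence between irrational numbers `t > 1` and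
sequences of positive integers. A way in the tree cannot wander among the roots forever, and once it
moves away from a root it can never turn back. An end is therefore a piece together with an infinite
sequence (`exists_eventually_eq_wayOf`, `Xi_bijective`).

For the spheromorphisms the basic objects are cells. The irrational points of a cell are
parametrised by `y > 0` through a chart in `PGL₂(ℤ)`. By `Cell.Xi_chart` the end with parameter `y`
is the ray of the digits of `y + 1`, whatever the cell. So a transformation that carries one chart
to another with the same `y` acts on ends as the standard isomorphism between the two subtrees.
Cells are `(T)`-subtrees because both a cell and the whole tree are isomorphic to `seqTree`
(`nonempty_seqTree_iso_tree`). A finite partition of the ends into cells is a covering forest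
(`IsPartition.isCoveringForest`).

It remains to find a partition adapted to the transformation. Cutting a cell at `y = 1` gives the
cells `rest` and `child`. By Euclid's algorithm finitely many such cuts remove any finite set of
rational points from the interiors (`Cell.induction_avoiding`). Remove the break points and the
rational preimages of `∞, 0, 1, -1`. On each remaining cell the transformation is a single `γ` with
values in one piece, and division with remainder on its coefficients (`exists_contFrac_eq`) shows
that `γ` composed with the chart is again a chart, in `y` or in `y⁻¹`. Inversion exchanges the two
halves of a cell, so one more cut settles the second case.

Irrational points stay irrational because `γ` is integral and invertible. Rational break points,
where no `γ` is prescribed, are handled by continuity (`not_irrational_of_thompson`). -/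

theorem partialQuotient_zero (k : ℕ+) {t : ℝ} (ht : 1 < t) :
    partialQuotient (k + t⁻¹) 0 = k := by
  have h1 : t⁻¹ < 1 := inv_lt_one_of_one_lt₀ ht
  have h0 : 0 < t⁻¹ := by positivity
  have hf : ⌊((k : ℕ) : ℝ) + t⁻¹⌋ = ((k : ℕ) : ℤ) := by
    rw [Int.floor_eq_iff]
    push_cast
    constructor <;> linarith
  simp [partialQuotient, GenContFract.IntFractPair.stream_zero, GenContFract.IntFractPair.of, hf]

theorem partialQuotient_succ {x : ℝ} (hx : Int.fract x ≠ 0) (n : ℕ) :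
    partialQuotient x (n + 1) = partialQuotient (Int.fract x)⁻¹ n := by
  rw [partialQuotient, GenContFract.IntFractPair.stream_succ hx, partialQuotient]

theorem fract_natCast_add_inv (k : ℕ) {t : ℝ} (ht : 1 < t) :
    Int.fract (k + t⁻¹) = t⁻¹ := by
  rw [Int.fract_natCast_add, Int.fract_eq_self]
  exact ⟨by positivity, inv_lt_one_of_one_lt₀ ht⟩

/-- The integer part may be `0`; this case reads off the digits of numbers in `(0, 1)`. -/
theorem partialQuotient_add_inv_succ (k : ℕ) {t : ℝ} (ht : 1 < t) (n : ℕ) :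
    partialQuotient (k + t⁻¹) (n + 1) = partialQuotient t n := by
  have h0 : t⁻¹ ≠ 0 := by positivity
  rw [partialQuotient_succ, fract_natCast_add_inv k ht, inv_inv]
  rwa [fract_natCast_add_inv k ht]

theorem exists_eq_add_inv {x : ℝ} (hx : Irrational x) (h1 : 1 < x) :
    ∃ (k : ℕ+) (t : ℝ), Irrational t ∧ 1 < t ∧ x = k + t⁻¹ := by
  have hf : Int.fract x ≠ 0 := by
    intro h
    rw [Int.fract, sub_eq_zero] at h
    exact hx.ne_int _ h
  have hk : 1 ≤ ⌊x⌋ := Int.le_floor.2 (by exact_mod_cast h1.le)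
  have hp : 0 < Int.fract x := lt_of_le_of_ne (Int.fract_nonneg x) hf.symm
  refine ⟨⟨⌊x⌋.toNat, by omega⟩, (Int.fract x)⁻¹, ?_, ?_, ?_⟩
  · rw [irrational_inv_iff]
    exact hx.sub_intCast _
  · exact (one_lt_inv₀ hp).2 (Int.fract_lt_one x)
  · have : ((⌊x⌋.toNat : ℕ) : ℝ) = (⌊x⌋ : ℝ) := by
      rw [← Int.cast_natCast, Int.toNat_of_nonneg (by omega)]
    simp [this, Int.floor_add_fract]

/-- An irrational number `x > 1` is determined by its partial quotients. -/
theorem partialQuotient_injective {x y : ℝ} (hx : Irrational x) (hx1 : 1 < x)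
    (hy : Irrational y) (hy1 : 1 < y) (h : ∀ n, partialQuotient x n = partialQuotient y n) :
    x = y := by
  -- Two expansion steps at a time give a uniform contraction: the difference is divided by `(k' t'
  -- + 1)(k' u' + 1) ≥ 4`. A single step divides by `t u`, which can be arbitrarily close to `1`.
  have key : ∀ (n : ℕ) (x y : ℝ), Irrational x → 1 < x → Irrational y → 1 < y →
      (∀ n, partialQuotient x n = partialQuotient y n) → |x - y| * 4 ^ n ≤ 1 := by
    intro n
    induction n with
    | zero =>
      intro x y hx hx1 hy hy1 h
      obtain ⟨k, t, -, ht1, rfl⟩ := exists_eq_add_inv hx hx1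
      obtain ⟨l, u, -, hu1, rfl⟩ := exists_eq_add_inv hy hy1
      have hkl := h 0
      rw [partialQuotient_zero k ht1, partialQuotient_zero l hu1] at hkl
      subst hkl
      have := inv_lt_one_of_one_lt₀ ht1
      have := inv_lt_one_of_one_lt₀ hu1
      have : 0 < t⁻¹ := by positivity
      have : 0 < u⁻¹ := by positivity
      rw [pow_zero, mul_one, abs_le]
      constructor <;> linarith
    | succ n ih =>
      intro x y hx hx1 hy hy1 h
      obtain ⟨k, t, ht, ht1, rfl⟩ := exists_eq_add_inv hx hx1
      obtain ⟨l, u, hu, hu1, rfl⟩ := exists_eq_add_inv hy hy1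
      have hkl := h 0
      rw [partialQuotient_zero k ht1, partialQuotient_zero l hu1] at hkl
      subst hkl
      have h' : ∀ n, partialQuotient t n = partialQuotient u n := fun n => by
        have := h (n + 1)
        rwa [partialQuotient_add_inv_succ _ ht1, partialQuotient_add_inv_succ _ hu1] at this
      obtain ⟨k', t', ht', ht1', rfl⟩ := exists_eq_add_inv ht ht1
      obtain ⟨l', u', hu', hu1', rfl⟩ := exists_eq_add_inv hu hu1
      have hkl := h' 0
      rw [partialQuotient_zero _ ht1', partialQuotient_zero _ hu1'] at hkl
      subst hkl
      have h'' : ∀ n, partialQuotient t' n = partialQuotient u' n := fun n => by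
        have := h' (n + 1)
        rwa [partialQuotient_add_inv_succ _ ht1', partialQuotient_add_inv_succ _ hu1'] at this
      have hk1 : (1 : ℝ) ≤ ((k' : ℕ) : ℝ) := by exact_mod_cast (one_le : 1 ≤ k')
      have e : ((k : ℕ) : ℝ) + (((k' : ℕ) : ℝ) + t'⁻¹)⁻¹ - (k + (((k' : ℕ) : ℝ) + u'⁻¹)⁻¹) =
          (t' - u') / ((k' * t' + 1) * (k' * u' + 1)) := by
        have h1 : ((k' : ℕ) : ℝ) * t' + 1 ≠ 0 := by positivity
        have h2 : ((k' : ℕ) : ℝ) * u' + 1 ≠ 0 := by positivity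
        have h3 : t' ≠ 0 := by positivity
        have h4 : u' ≠ 0 := by positivity
        field_simp
        ring
      have hb : (4 : ℝ) ≤ (k' * t' + 1) * (k' * u' + 1) := by
        have h1 : (2 : ℝ) ≤ k' * t' + 1 := by nlinarith
        have h2 : (2 : ℝ) ≤ k' * u' + 1 := by nlinarith
        nlinarith
      have hi := ih t' u' ht' ht1' hu' hu1' h''
      rw [e, abs_div, abs_of_pos (by linarith : (0:ℝ) < (k' * t' + 1) * (k' * u' + 1)), pow_succ,
        div_mul_eq_mul_div, div_le_iff₀ (by linarith)]
      nlinarith [abs_nonneg (t' - u')]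
  by_contra hne
  have hpos : 0 < |x - y| := abs_pos.2 (sub_ne_zero.2 hne)
  obtain ⟨n, hn⟩ := pow_unbounded_of_one_lt (|x - y|⁻¹) (by norm_num : (1 : ℝ) < 4)
  have := key n x y hx hx1 hy hy1 h
  rw [inv_lt_iff_one_lt_mul₀ hpos] at hn
  linarith

/-- Complete quotients for a prescribed sequence of partial quotients. -/
theorem exists_completeQuotients (s : ℕ → ℕ+) :
    ∃ x : ℕ → ℝ, ∀ k, 1 < x k ∧ x k = s k + (x (k + 1))⁻¹ := by
  -- Compactness replaces convergence of the convergents. The first `n` recursion equations cut out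
  -- nested closed sets in a product of compact intervals, and they are cleared of denominators so
  -- that closedness is immediate.
  let K : Set (ℕ → ℝ) := Set.pi Set.univ fun k => Set.Icc 1 ((s k : ℝ) + 1)
  have hK : IsCompact K := isCompact_univ_pi fun k => isCompact_Icc
  let A : ℕ → Set (ℕ → ℝ) := fun n => K ∩ {x | ∀ k < n, x k * x (k + 1) = s k * x (k + 1) + 1}
  have hcl : ∀ n, IsClosed (A n) := fun n => by
    refine hK.isClosed.inter ?_
    simp only [Set.ofPred_forall]
    refine isClosed_iInter fun k => isClosed_iInter fun _ => isClosed_eq ?_ ?_ <;> fun_prop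
  have hne : ∀ (n : ℕ) (s : ℕ → ℕ+), ∃ x : ℕ → ℝ, (∀ k, 1 ≤ x k ∧ x k ≤ (s k : ℝ) + 1) ∧
      ∀ k < n, x k * x (k + 1) = s k * x (k + 1) + 1 := by
    intro n
    induction n with
    | zero => exact fun s => ⟨fun _ => 1, fun k => by simp, by simp⟩
    | succ n ih =>
      intro s
      obtain ⟨x, hx, hx'⟩ := ih fun k => s (k + 1)
      have h0 := (hx 0).1
      have hs : (1 : ℝ) ≤ ((s 0 : ℕ) : ℝ) := by exact_mod_cast (one_le : 1 ≤ (s) 0)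
      refine ⟨fun k => if k = 0 then s 0 + (x 0)⁻¹ else x (k - 1), fun k => ?_, fun k hk => ?_⟩
      · cases k with
        | zero =>
          have h1 : (x 0)⁻¹ ≤ 1 := inv_le_one_of_one_le₀ h0
          have h2 : 0 < (x 0)⁻¹ := by positivity
          simp only [if_true]
          exact ⟨by linarith, by linarith⟩
        | succ k => simpa using hx k
      · cases k with
        | zero =>
          have : x 0 ≠ 0 := by positivity
          simp only [if_true, zero_add, one_ne_zero, if_false, Nat.sub_self]
          field_simp
        | succ k => simpa using hx' k (by omega)
  obtain ⟨x, hx⟩ := IsCompact.nonempty_iInter_of_sequence_nonempty_isCompact_isClosed A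
    (fun n x hx => ⟨hx.1, fun k hk => hx.2 k (by omega)⟩)
    (fun n => by
      obtain ⟨x, hx, hx'⟩ := hne n s
      exact ⟨x, fun k _ => hx k, hx'⟩)
    (hK.inter_right (by simp)) hcl
  have hx' : ∀ n, x ∈ A n := by simpa using hx
  have h1 : ∀ k, 1 ≤ x k := fun k => ((hx' 0).1 k trivial).1
  have h2 : ∀ k, x k = s k + (x (k + 1))⁻¹ := fun k => by
    have h := (hx' (k + 1)).2 k (by omega)
    have : x (k + 1) ≠ 0 := by linarith [h1 (k + 1)]
    field_simp
    linarith
  -- The compact sets give only `1 ≤ x k`; the recursion makes the inequality strict.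
  refine ⟨x, fun k => ⟨?_, h2 k⟩⟩
  have hs : (1 : ℝ) ≤ ((s k : ℕ) : ℝ) := by exact_mod_cast (one_le : 1 ≤ (s) k)
  have : 0 < (x (k + 1))⁻¹ := by have := h1 (k + 1); positivity
  rw [h2 k]
  linarith

/-- Every sequence of positive integers is the sequence of partial quotients of an irrational
number `t > 1`. -/
theorem exists_partialQuotient_eq (s : ℕ → ℕ+) :
    ∃ t : ℝ, Irrational t ∧ 1 < t ∧ partialQuotient t = s := by
  obtain ⟨x, hx⟩ := exists_completeQuotients s
  refine ⟨x 0, ?_, (hx 0).1, ?_⟩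
  · rintro ⟨q, hq⟩
    obtain ⟨n, hn⟩ := GenContFract.IntFractPair.exists_nth_stream_eq_none_of_rat q
    have h := GenContFract.IntFractPair.coe_stream_nth_rat_eq hq.symm n
    rw [hn] at h
    -- The expansion of a rational number terminates, whereas here every fractional part `(x (k +
    -- 1))⁻¹` is nonzero.
    have key : ∀ n k, GenContFract.IntFractPair.stream (x k) n ≠ none := by
      intro n
      induction n with
      | zero => simp [GenContFract.IntFractPair.stream_zero]
      | succ n ih =>
        intro k
        have hf : Int.fract (x k) = (x (k + 1))⁻¹ := by
          rw [(hx k).2]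
          exact fract_natCast_add_inv _ (hx (k + 1)).1
        have h0 : (x (k + 1))⁻¹ ≠ 0 := by have := (hx (k + 1)).1; positivity
        rw [GenContFract.IntFractPair.stream_succ (by rwa [hf]), hf, inv_inv]
        exact ih (k + 1)
    exact key n 0 h.symm
  · have key : ∀ n k, partialQuotient (x k) n = s (k + n) := by
      intro n
      induction n with
      | zero =>
        intro k
        rw [(hx k).2, partialQuotient_zero _ (hx (k + 1)).1, add_zero]
      | succ n ih =>
        intro k
        rw [(hx k).2, partialQuotient_add_inv_succ _ (hx (k + 1)).1, ih (k + 1)]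
        congr 1
        omega
    funext n
    simpa using key n 0

/-! ### Charts -/

/-- The infinite sequence which begins with the word `w` and continues with `s`. -/
def appendSeq : List ℕ+ → (ℕ → ℕ+) → ℕ → ℕ+
  | [], s, n => s n
  | a :: _, _, 0 => a
  | _ :: w, s, n + 1 => appendSeq w s n

/-- The sum of a positive integer and a natural number, as a positive integer. -/
def addNat (a : ℕ+) (m : ℕ) : ℕ+ := ⟨a + m, Nat.add_pos_left a.pos m⟩

theorem coe_addNat (a : ℕ+) (m : ℕ) : (addNat a m : ℕ) = a + m := rfl

theorem addNat_injective (m : ℕ) : Function.Injective (addNat · m) := fun _ _ h =>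
  PNat.eq (Nat.add_right_cancel (congrArg PNat.val h))

theorem exists_addNat_eq {a : ℕ+} {m : ℕ} (h : m < a) : ∃ b, addNat b m = a :=
  ⟨⟨a - m, Nat.sub_pos_of_lt h⟩, PNat.eq (Nat.sub_add_cancel h.le)⟩

/-- Add `m` to the first term of a sequence. -/
def shiftHead (m : ℕ) (s : ℕ → ℕ+) : ℕ → ℕ+
  | 0 => addNat (s 0) m
  | n + 1 => s (n + 1)

/-- The continued fraction `[w₁; w₂, …, wₖ, t]`. -/
noncomputable def contFrac : List ℕ+ → ℝ → ℝ
  | [], t => t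
  | a :: w, t => a + (contFrac w t)⁻¹

/-- The bijection of the half-line `(1, ∞)` with the piece `p`. -/
noncomputable def pieceMap : Piece → ℝ → ℝ
  | .negOuter, t => -t
  | .negInner, t => -t⁻¹
  | .posInner, t => t⁻¹
  | .posOuter, t => t

theorem one_lt_contFrac (w : List ℕ+) {t : ℝ} (ht : 1 < t) : 1 < contFrac w t := by
  induction w with
  | nil => exact ht
  | cons a w ih =>
    have ha : (1 : ℝ) ≤ ((a : ℕ) : ℝ) := by exact_mod_cast (one_le : 1 ≤ a)
    have : 0 < (contFrac w t)⁻¹ := by positivity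
    simp only [contFrac]
    linarith

theorem irrational_contFrac (w : List ℕ+) {t : ℝ} : Irrational (contFrac w t) ↔ Irrational t := by
  induction w with
  | nil => rfl
  | cons a w ih => rw [contFrac, irrational_natCast_add_iff, irrational_inv_iff, ih]

theorem contFrac_append (w v : List ℕ+) (t : ℝ) :
    contFrac (w ++ v) t = contFrac w (contFrac v t) := by
  induction w with
  | nil => rfl
  | cons a w ih => simp [contFrac, ih]

theorem partialQuotient_contFrac (w : List ℕ+) {t : ℝ} (ht : 1 < t) :
    partialQuotient (contFrac w t) = appendSeq w (partialQuotient t) := by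
  induction w with
  | nil => rfl
  | cons a w ih =>
    funext n
    cases n with
    | zero => exact partialQuotient_zero a (one_lt_contFrac w ht)
    | succ n =>
      rw [contFrac, partialQuotient_add_inv_succ a (one_lt_contFrac w ht), ih]
      rfl

theorem partialQuotient_add_natCast (m : ℕ) {t : ℝ} (hi : Irrational t) (ht : 1 < t) :
    partialQuotient (t + m) = shiftHead m (partialQuotient t) := by
  obtain ⟨k, u, -, hu, rfl⟩ := exists_eq_add_inv hi ht
  have e : ((k : ℕ) : ℝ) + u⁻¹ + m = (addNat k m : ℕ) + u⁻¹ := by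
    rw [coe_addNat]
    push_cast
    ring
  rw [e]
  funext n
  cases n with
  | zero =>
    refine (partialQuotient_zero _ hu).trans ?_
    simp only [shiftHead, partialQuotient_zero _ hu]
  | succ n =>
    refine (partialQuotient_add_inv_succ _ hu n).trans ?_
    exact (partialQuotient_add_inv_succ _ hu n).symm

theorem irrational_pieceMap (p : Piece) {t : ℝ} : Irrational (pieceMap p t) ↔ Irrational t := by
  cases p <;> simp [pieceMap]

theorem piece_pieceMap (p : Piece) {t : ℝ} (ht : 1 < t) : piece (pieceMap p t) = p := by
  have h0 : 0 < t⁻¹ := by positivity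
  have h1 : t⁻¹ < 1 := inv_lt_one_of_one_lt₀ ht
  cases p <;> unfold piece
  · exact if_pos (show -t < -1 by linarith)
  · exact (if_neg (show ¬ -t⁻¹ < -1 by linarith)).trans (if_pos (show -t⁻¹ < 0 by linarith))
  · exact (if_neg (show ¬ t⁻¹ < -1 by linarith)).trans
      ((if_neg (show ¬ t⁻¹ < 0 by linarith)).trans (if_pos h1))
  · exact (if_neg (show ¬ t < -1 by linarith)).trans
      ((if_neg (show ¬ t < 0 by linarith)).trans (if_neg (show ¬ t < 1 by linarith)))

theorem digits_pieceMap (p : Piece) {t : ℝ} (ht : 1 < t) :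
    digits (pieceMap p t) = partialQuotient t := by
  have h0 : 0 < t⁻¹ := by positivity
  have hz : ∀ n, partialQuotient t⁻¹ (n + 1) = partialQuotient t n := fun n => by
    have := partialQuotient_add_inv_succ 0 ht n
    rwa [Nat.cast_zero, zero_add] at this
  funext n
  rw [digits, piece_pieceMap p ht]
  cases p <;> simp only [pieceMap, abs_neg, abs_of_pos h0, abs_of_pos (by linarith : 0 < t), hz]

theorem exists_pieceMap_eq {x : ℝ} (h0 : x ≠ 0) (h1 : x ≠ 1) (h2 : x ≠ -1) :
    ∃ (p : Piece) (t : ℝ), 1 < t ∧ pieceMap p t = x := by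
  rcases lt_or_gt_of_ne h2 with h | h
  · exact ⟨.negOuter, -x, by linarith, by simp [pieceMap]⟩
  rcases lt_or_gt_of_ne h0 with h' | h'
  · exact ⟨.negInner, (-x)⁻¹, (one_lt_inv₀ (by linarith)).2 (by linarith), by simp [pieceMap]⟩
  rcases lt_or_gt_of_ne h1 with h'' | h''
  · exact ⟨.posInner, x⁻¹, (one_lt_inv₀ h').2 h'', by simp [pieceMap]⟩
  · exact ⟨.posOuter, x, h'', rfl⟩

theorem exists_pieceMap_eq_of_irrational {x : ℝ} (hx : Irrational x) :
    ∃ (p : Piece) (t : ℝ), Irrational t ∧ 1 < t ∧ pieceMap p t = x := by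
  obtain ⟨p, t, ht, rfl⟩ := exists_pieceMap_eq hx.ne_zero hx.ne_one
    (by simpa using hx.ne_int (-1))
  exact ⟨p, t, (irrational_pieceMap p).1 hx, ht, rfl⟩

/-! ### Ends of the tree -/

instance : Finite Piece :=
  Finite.of_surjective (fun i : Fin 4 => ![Piece.negOuter, .negInner, .posInner, .posOuter] i)
    fun p => by cases p; exacts [⟨0, rfl⟩, ⟨1, rfl⟩, ⟨2, rfl⟩, ⟨3, rfl⟩]

theorem map_range_appendSeq (w : List ℕ+) (s : ℕ → ℕ+) (j : ℕ) :
    (List.range (w.length + j)).map (appendSeq w s) = w ++ (List.range j).map s := by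
  induction w with
  | nil => simp only [List.length_nil, zero_add, List.nil_append]; rfl
  | cons a w ih =>
    rw [List.length_cons, add_right_comm, List.range_succ_eq_map, List.map_cons, List.map_map,
      List.cons_append, ← ih]
    rfl

/-- Without a descending step, every step shortens the word or passes between roots. Shortening must
stop, and then the way is confined to finitely many roots, against injectivity. -/
theorem exists_descent {C : SimpleGraph Piece} (a : Way (tree C)) :
    ∃ n, ∃ s : ℕ+, a.toFun (n + 1) = ((a.toFun n).1, (a.toFun n).2 ++ [s]) := by
  by_contra! hno
  have step : ∀ n, ((a.toFun n).2.length = (a.toFun (n + 1)).2.length + 1) ∨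
      ((a.toFun n).2 = [] ∧ (a.toFun (n + 1)).2 = []) := by
    intro n
    rcases a.adj n with ⟨h1, s, h | h⟩ | ⟨h1, h2, -⟩
    · exact (hno n s (Prod.ext h1.symm h)).elim
    · exact Or.inl (by rw [h]; simp)
    · exact Or.inr ⟨h1, h2⟩
  have hnil : ∃ n, (a.toFun n).2 = [] := by
    by_contra! hne
    have key : ∀ n, (a.toFun n).2.length + n = (a.toFun 0).2.length := by
      intro n
      induction n with
      | zero => rfl
      | succ n ih =>
        rcases step n with h | h
        · omega
        · exact absurd h.1 (hne n)
    have := key ((a.toFun 0).2.length + 1)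
    omega
  obtain ⟨n, hn⟩ := hnil
  have hall : ∀ j, (a.toFun (n + j)).2 = [] := by
    intro j
    induction j with
    | zero => exact hn
    | succ j ih =>
      rcases step (n + j) with h | h
      · rw [ih] at h
        simp at h
      · exact h.2
  refine not_injective_infinite_finite (fun j => (a.toFun (n + j)).1) fun i j hij => ?_
  have := a.injective (Prod.ext hij ((hall i).trans (hall j).symm))
  omega

/-- Every end of the tree is represented by one of the ways `wayOf C p s`. -/
theorem exists_eventually_eq_wayOf {C : SimpleGraph Piece} (a : Way (tree C)) :
    ∃ p s, ∃ m n : ℕ, ∀ j, a.toFun (m + j) = (wayOf C p s).toFun (n + j) := by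
  obtain ⟨n, hn⟩ := exists_descent a
  -- Descent persists: stepping back up would repeat the previous vertex, and edges between copies
  -- are available only at empty words.
  have hdesc : ∀ j, ∃ s : ℕ+, a.toFun (n + j + 1) =
      ((a.toFun (n + j)).1, (a.toFun (n + j)).2 ++ [s]) := by
    intro j
    induction j with
    | zero => exact hn
    | succ j ih =>
      obtain ⟨s, hs⟩ := ih
      rcases a.adj (n + j + 1) with ⟨h1, t, h | h⟩ | ⟨h1, -, -⟩
      · exact ⟨t, Prod.ext h1.symm h⟩
      · have hts : (a.toFun (n + j)).2 = (a.toFun (n + j + 1 + 1)).2 := by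
          rw [hs] at h
          exact (List.append_inj' h rfl).1
        have h1' : (a.toFun (n + j)).1 = (a.toFun (n + j + 1 + 1)).1 := by
          rw [← h1, hs]
        have := a.injective (Prod.ext h1' hts)
        omega
      · rw [hs] at h1
        simp at h1
  choose d hd using hdesc
  have key : ∀ j, a.toFun (n + j) =
      ((a.toFun n).1, (a.toFun n).2 ++ (List.range j).map d) := by
    intro j
    induction j with
    | zero => simp
    | succ j ih =>
      rw [← add_assoc, hd j, ih, List.range_succ]
      simp
  refine ⟨(a.toFun n).1, appendSeq (a.toFun n).2 d, n, (a.toFun n).2.length, fun j => ?_⟩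
  rw [key]
  exact Prod.ext rfl (map_range_appendSeq _ _ _).symm

theorem endOf_eq_of_eventually_eq {V : Type*} {G : SimpleGraph V} {a b : Way G}
    (h : ∃ m n : ℕ, ∀ j, a.toFun (m + j) = b.toFun (n + j)) : endOf a = endOf b :=
  Quotient.sound h

/-- The length of the word records the position on the way, so two equivalent ways of this form
coincide without any shift. -/
theorem endOf_wayOf_injective {C : SimpleGraph Piece} {p q : Piece} {s t : ℕ → ℕ+}
    (h : endOf (wayOf C p s) = endOf (wayOf C q t)) : p = q ∧ s = t := by
  obtain ⟨m, n, hmn⟩ : ∃ m n : ℕ, ∀ j, (wayOf C p s).toFun (m + j) =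
    (wayOf C q t).toFun (n + j) := Quotient.exact h
  have hp : p = q := congrArg (fun v : Piece × List ℕ+ => v.1) (hmn 0)
  have hl : m = n := by
    simpa [wayOf] using congrArg (fun v : Piece × List ℕ+ => v.2.length) (hmn 0)
  subst hl
  refine ⟨hp, funext fun k => ?_⟩
  have h2 : (List.range (m + (k + 1))).map s = (List.range (m + (k + 1))).map t :=
    congrArg (fun v : Piece × List ℕ+ => v.2) (hmn (k + 1))
  exact List.map_inj_left.1 h2 k (List.mem_range.2 (by omega))

theorem Xi_pieceMap (C : SimpleGraph Piece) (p : Piece) {t : ℝ} (ht : 1 < t)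
    (h : Irrational (pieceMap p t)) :
    Xi C ⟨pieceMap p t, h⟩ = endOf (wayOf C p (partialQuotient t)) := by
  rw [Xi, piece_pieceMap p ht, digits_pieceMap p ht]

theorem Xi_bijective (C : SimpleGraph Piece) : Function.Bijective (Xi C) := by
  constructor
  · rintro ⟨x, hx⟩ ⟨y, hy⟩ h
    obtain ⟨p, t, hti, ht, rfl⟩ := exists_pieceMap_eq_of_irrational hx
    obtain ⟨q, u, hui, hu, rfl⟩ := exists_pieceMap_eq_of_irrational hy
    rw [Xi_pieceMap C p ht, Xi_pieceMap C q hu] at h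
    obtain ⟨rfl, hs⟩ := endOf_wayOf_injective h
    obtain rfl := partialQuotient_injective hti ht hui hu (congrFun hs)
    rfl
  · intro e
    obtain ⟨a, rfl⟩ := Quotient.exists_rep e
    obtain ⟨p, s, h⟩ := exists_eventually_eq_wayOf a
    obtain ⟨t, hti, ht, rfl⟩ := exists_partialQuotient_eq s
    refine ⟨⟨pieceMap p t, (irrational_pieceMap p).2 hti⟩, ?_⟩
    rw [Xi_pieceMap C p ht]
    exact (endOf_eq_of_eventually_eq h).symm

/-! ### The tree of finite sequences and its copies -/

/-- The tree of finite sequences of positive integers. -/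
def seqTree : SimpleGraph (List ℕ+) where
  Adj v w := ∃ s : ℕ+, w = v ++ [s] ∨ v = w ++ [s]
  symm := ⟨fun _ _ ⟨s, h⟩ => ⟨s, h.symm⟩⟩
  loopless := ⟨by
    rintro v ⟨s, hs | hs⟩ <;> simpa using congrArg List.length hs⟩

/-- Add `m` to the first term of a finite sequence. -/
def shiftHeadList (m : ℕ) : List ℕ+ → List ℕ+
  | [] => []
  | a :: u => addNat a m :: u

theorem shiftHeadList_zero (u : List ℕ+) : shiftHeadList 0 u = u := by
  cases u <;> rfl

theorem shiftHeadList_injective (m : ℕ) : Function.Injective (shiftHeadList m) := by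
  rintro (_ | ⟨a, u⟩) (_ | ⟨b, v⟩) h
  · rfl
  · simp [shiftHeadList] at h
  · simp [shiftHeadList] at h
  · simp only [shiftHeadList, List.cons.injEq] at h
    rw [addNat_injective m h.1, h.2]

theorem map_range_shiftHead (m : ℕ) (s : ℕ → ℕ+) (j : ℕ) :
    (List.range j).map (shiftHead m s) = shiftHeadList m ((List.range j).map s) := by
  cases j with
  | zero => rfl
  | succ j =>
    rw [List.range_succ_eq_map, List.map_cons, List.map_cons, List.map_map, List.map_map]
    rfl

theorem shiftHeadList_append (m : ℕ) {u : List ℕ+} (hu : u ≠ []) (v : List ℕ+) :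
    shiftHeadList m (u ++ v) = shiftHeadList m u ++ v := by
  cases u with
  | nil => exact absurd rfl hu
  | cons a u => rfl

theorem exists_shiftHeadList_eq_append (m : ℕ) (u v : List ℕ+) :
    (∃ s : ℕ+, shiftHeadList m v = shiftHeadList m u ++ [s]) ↔ ∃ s : ℕ+, v = u ++ [s] := by
  cases u with
  | nil =>
    rcases v with _ | ⟨a, _ | ⟨b, v⟩⟩ <;> simp [shiftHeadList]
  | cons a u =>
    simp only [← shiftHeadList_append m (List.cons_ne_nil a u),
      (shiftHeadList_injective m).eq_iff]

/-- The data `(p, w, m)` of a subtree of the `p`-th copy: its vertices are `w` and the sequences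
which continue `w` by a term greater than `m`. Its ends are the points of a Farey interval. -/
structure Cell where
  piece : Piece
  word : List ℕ+
  shift : ℕ

/-- The parametrization of the vertices of a cell by all finite sequences. -/
def Cell.vertex (ν : Cell) (u : List ℕ+) : Piece × List ℕ+ :=
  (ν.piece, ν.word ++ shiftHeadList ν.shift u)

/-- The parametrization of the ends of a cell by all sequences. -/
def Cell.ray (ν : Cell) (s : ℕ → ℕ+) : ℕ → ℕ+ :=
  appendSeq ν.word (shiftHead ν.shift s)

/-- The parametrization of the irrational points of a cell by positive irrational numbers. -/
noncomputable def Cell.chart (ν : Cell) (y : ℝ) : ℝ :=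
  pieceMap ν.piece (contFrac ν.word (y + 1 + ν.shift))

/-- The tree of finite sequences is embedded as a cell. -/
def Cell.embedding (C : SimpleGraph Piece) (ν : Cell) : seqTree ↪g tree C where
  toFun := ν.vertex
  inj' u v h := by
    simp only [Cell.vertex, Prod.mk.injEq, List.append_cancel_left_eq, true_and] at h
    exact shiftHeadList_injective _ h
  map_rel_iff' {u v} := by
    have h : ∀ u v, (∃ s : ℕ+, (ν.vertex v).2 = (ν.vertex u).2 ++ [s]) ↔ ∃ s : ℕ+, v = u ++ [s] :=
      fun u v => by
        simp only [Cell.vertex, List.append_assoc, List.append_cancel_left_eq,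
          exists_shiftHeadList_eq_append]
    have h' : (tree C).Adj (ν.vertex u) (ν.vertex v) ↔
        ∃ s : ℕ+, (ν.vertex v).2 = (ν.vertex u).2 ++ [s] ∨
          (ν.vertex u).2 = (ν.vertex v).2 ++ [s] :=
      ⟨fun h => h.elim (fun h => h.2) fun h => absurd h.2.2 (C.loopless.irrefl _),
        fun h => Or.inl ⟨rfl, h⟩⟩
    refine h'.trans ?_
    rw [exists_or, h, h, ← exists_or]
    rfl

/-- Every way in the tree of finite sequences runs eventually through the initial segments of an
infinite sequence. -/
theorem exists_eventually_eq_initialSegment (b : Way seqTree) :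
    ∃ s : ℕ → ℕ+, ∃ m n : ℕ, ∀ j, b.toFun (m + j) = (List.range (n + j)).map s := by
  -- The cell with empty word and shift `0` embeds the sequences unchanged, so the result for the
  -- joined tree applies, even with no joining edges.
  obtain ⟨p, s, m, n, h⟩ := exists_eventually_eq_wayOf
    (b.map (Cell.embedding ⊥ ⟨Piece.posOuter, [], 0⟩))
  refine ⟨s, m, n, fun j => ?_⟩
  have := congrArg (fun v : Piece × List ℕ+ => v.2) (h j)
  exact (shiftHeadList_zero _).symm.trans this

theorem endOf_map_embedding (C : SimpleGraph Piece) (ν : Cell) {b : Way seqTree} {s : ℕ → ℕ+}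
    {m n : ℕ} (h : ∀ j, b.toFun (m + j) = (List.range (n + j)).map s) :
    endOf (b.map (ν.embedding C)) = endOf (wayOf C ν.piece (ν.ray s)) := by
  refine endOf_eq_of_eventually_eq ⟨m, ν.word.length + n, fun j => ?_⟩
  refine Prod.ext_iff.2 ⟨rfl, ?_⟩
  change ν.word ++ shiftHeadList ν.shift (b.toFun (m + j)) = (List.range _).map (ν.ray s)
  rw [h, Cell.ray, add_assoc, map_range_appendSeq, map_range_shiftHead]

theorem Cell.chart_irrational (ν : Cell) {y : ℝ} : Irrational (ν.chart y) ↔ Irrational y := by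
  rw [Cell.chart, irrational_pieceMap, irrational_contFrac, irrational_add_natCast_iff,
    show y + 1 = y + (1 : ℕ) by simp, irrational_add_natCast_iff]

/-- The sequence fed into `ray` depends on `y` alone and not on the cell. Hence matching charts of
two cells amounts to matching their rays. -/
theorem Cell.Xi_chart (C : SimpleGraph Piece) (ν : Cell) {y : ℝ} (hy : 0 < y)
    (hi : Irrational (ν.chart y)) :
    Xi C ⟨ν.chart y, hi⟩ = endOf (wayOf C ν.piece (ν.ray (partialQuotient (y + 1)))) := by
  have hm : (0 : ℝ) ≤ ν.shift := Nat.cast_nonneg _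
  have h1 : 1 < y + 1 + ν.shift := by linarith
  have hi' : Irrational (y + 1) := by
    simpa using (ν.chart_irrational.1 hi).add_natCast 1
  refine (Xi_pieceMap C ν.piece (one_lt_contFrac _ h1) hi).trans ?_
  rw [partialQuotient_contFrac _ h1, partialQuotient_add_natCast _ hi' (by linarith), Cell.ray]

/-! ### All cells are isomorphic to the whole tree -/

/-- Copies of the tree of finite sequences, indexed by the vertices of a graph `C` and joined at
their initial points according to `C`. -/
def joinedTree {ι : Type*} (C : SimpleGraph ι) : SimpleGraph (ι × List ℕ+) where
  Adj v w := (v.1 = w.1 ∧ seqTree.Adj v.2 w.2) ∨ (v.2 = [] ∧ w.2 = [] ∧ C.Adj v.1 w.1)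
  symm := ⟨by
    rintro v w (⟨h, hs⟩ | ⟨hv, hw, h⟩)
    · exact Or.inl ⟨h.symm, hs.symm⟩
    · exact Or.inr ⟨hw, hv, h.symm⟩⟩
  loopless := ⟨by
    rintro v (⟨-, h⟩ | ⟨-, -, h⟩)
    · exact seqTree.loopless.irrefl _ h
    · exact C.loopless.irrefl _ h⟩

theorem seqTree_adj_shiftHeadList (m : ℕ) (u v : List ℕ+) :
    seqTree.Adj (shiftHeadList m u) (shiftHeadList m v) ↔ seqTree.Adj u v := by
  change (∃ s : ℕ+, _ ∨ _) ↔ (∃ s : ℕ+, _ ∨ _)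
  rw [exists_or, exists_or, exists_shiftHeadList_eq_append, exists_shiftHeadList_eq_append]

theorem seqTree_adj_cons (a : ℕ+) (u v : List ℕ+) :
    seqTree.Adj (a :: u) (a :: v) ↔ seqTree.Adj u v := by
  simp [seqTree]

theorem shiftHeadList_eq_nil {m : ℕ} {u : List ℕ+} : shiftHeadList m u = [] ↔ u = [] := by
  cases u <;> simp [shiftHeadList]

/-- Shifted words never begin with `1`, so the branch through `1` touches them only along the edge
from the empty word to `[1]`. -/
theorem seqTree_adj_one_cons_shiftHeadList (t v : List ℕ+) :
    seqTree.Adj (1 :: t) (shiftHeadList 1 v) ↔ t = [] ∧ v = [] := by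
  constructor
  · rintro ⟨s, h | h⟩
    · cases v with
      | nil => simp [shiftHeadList] at h
      | cons a v =>
        have h1 : addNat a 1 = 1 := by simpa [shiftHeadList] using congrArg List.head? h
        have := congrArg PNat.val h1
        have := a.pos
        rw [PNat.val_ofNat, coe_addNat] at *
        omega
    · cases v with
      | nil => simpa [shiftHeadList] using (List.cons.inj h).2
      | cons a v =>
        have h1 : 1 = addNat a 1 := by simpa [shiftHeadList] using congrArg List.head? h
        have := congrArg PNat.val h1
        have := a.pos
        rw [PNat.val_ofNat, coe_addNat] at *
        omega
  · rintro ⟨rfl, rfl⟩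
    exact ⟨1, Or.inr rfl⟩

section leaf

variable {ι : Type*} [DecidableEq ι] (l q : ι)

/-- Attach the copy with index `l` to the copy with index `q`, as the continuations of `1`. -/
def absorbLeaf (hq : q ≠ l) (v : ι × List ℕ+) : {i // i ≠ l} × List ℕ+ :=
  if h : v.1 = l then (⟨q, hq⟩, 1 :: v.2)
  else (⟨v.1, h⟩, shiftHeadList (if v.1 = q then 1 else 0) v.2)

theorem absorbLeaf_leaf (hq : q ≠ l) (u : List ℕ+) :
    absorbLeaf l q hq (l, u) = (⟨q, hq⟩, 1 :: u) := by
  simp [absorbLeaf]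

theorem absorbLeaf_of_ne (hq : q ≠ l) {i : ι} (hi : i ≠ l) (u : List ℕ+) :
    absorbLeaf l q hq (i, u) = (⟨i, hi⟩, shiftHeadList (if i = q then 1 else 0) u) := by
  simp [absorbLeaf, hi]

/-- Hilbert's hotel: raising the first terms in copy `q` by one vacates exactly the words that begin
with `1`, and the copy `l` fills them. -/
theorem absorbLeaf_bijective (hq : q ≠ l) : Function.Bijective (absorbLeaf l q hq) := by
  constructor
  · have key : ∀ u i v, i ≠ l → absorbLeaf l q hq (l, u) ≠ absorbLeaf l q hq (i, v) := by
      intro u i v hi h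
      rw [absorbLeaf_leaf, absorbLeaf_of_ne l q hq hi, Prod.mk.injEq, Subtype.mk.injEq] at h
      obtain ⟨rfl, h⟩ := h
      rw [if_pos rfl] at h
      cases v with
      | nil => simp [shiftHeadList] at h
      | cons a v =>
        have h1 := congrArg PNat.val (List.cons.inj h).1
        rw [PNat.val_ofNat, coe_addNat] at h1
        have := a.pos
        omega
    rintro ⟨i, u⟩ ⟨j, v⟩ h
    rcases eq_or_ne i l with rfl | hi <;> rcases eq_or_ne j i with rfl | hj
    · simpa [absorbLeaf_leaf] using h
    · exact absurd h (key _ _ _ hj)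
    · rw [absorbLeaf_of_ne l q hq hi, absorbLeaf_of_ne l q hq hi, Prod.mk.injEq] at h
      rw [shiftHeadList_injective _ h.2]
    · rcases eq_or_ne j l with rfl | hj'
      · exact absurd h.symm (key _ _ _ hi)
      · rw [absorbLeaf_of_ne l q hq hi, absorbLeaf_of_ne l q hq hj', Prod.mk.injEq,
          Subtype.mk.injEq] at h
        exact absurd h.1.symm hj
  · rintro ⟨⟨i, hi⟩, u⟩
    by_cases hiq : i = q
    · subst hiq
      rcases u with _ | ⟨a, u⟩
      · exact ⟨(i, []), by rw [absorbLeaf_of_ne l i hq hi]; rfl⟩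
      · by_cases ha : a = 1
        · subst ha
          exact ⟨(l, u), absorbLeaf_leaf l i hq u⟩
        · have h1 : 1 < (a : ℕ) := by
            have := a.pos
            have : (a : ℕ) ≠ 1 := fun h => ha (PNat.eq h)
            omega
          obtain ⟨b, rfl⟩ := exists_addNat_eq h1
          exact ⟨(i, b :: u), by rw [absorbLeaf_of_ne l i hq hi, if_pos rfl, shiftHeadList]⟩
    · refine ⟨(i, u), ?_⟩
      rw [absorbLeaf_of_ne l q hq hi, if_neg hiq, shiftHeadList_zero]

/-- Since `l` is a leaf of `C`, its copy hangs on a single edge, between the roots of `l` and `q`.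
This edge becomes the edge from the empty word to `[1]`. -/
theorem absorbLeaf_adj {C : SimpleGraph ι} (hq : q ≠ l) (hl : ∀ j, C.Adj l j ↔ j = q)
    (v w : ι × List ℕ+) :
    (joinedTree (C.comap (Subtype.val : {i // i ≠ l} → ι))).Adj (absorbLeaf l q hq v) (absorbLeaf l q hq w) ↔
      (joinedTree C).Adj v w := by
  have key : ∀ u j v, j ≠ l → ((joinedTree (C.comap (Subtype.val : {i // i ≠ l} → ι))).Adj (absorbLeaf l q hq (l, u))
      (absorbLeaf l q hq (j, v)) ↔ (joinedTree C).Adj (l, u) (j, v)) := by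
    intro u j v hj
    rw [absorbLeaf_leaf, absorbLeaf_of_ne l q hq hj]
    by_cases hjq : j = q
    · subst hjq
      simp [joinedTree, seqTree_adj_one_cons_shiftHeadList, hl, hq.symm]
    · simp [joinedTree, hl, hjq, hj.symm, Ne.symm hjq]
  obtain ⟨i, u⟩ := v
  obtain ⟨j, v⟩ := w
  rcases eq_or_ne i l with rfl | hi
  · rcases eq_or_ne j i with rfl | hj
    · simp [absorbLeaf_leaf, joinedTree, seqTree_adj_cons]
    · exact key _ _ _ hj
  · rcases eq_or_ne j l with rfl | hj
    · rw [SimpleGraph.adj_comm, key _ _ _ hi, SimpleGraph.adj_comm]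
    · rw [absorbLeaf_of_ne l q hq hi, absorbLeaf_of_ne l q hq hj]
      by_cases hij : i = j
      · subst hij
        simp [joinedTree, seqTree_adj_shiftHeadList]
      · simp [joinedTree, hij, shiftHeadList_eq_nil]

end leaf

/-- A single copy of the tree of finite sequences. -/
def joinedTreeOfUnique {ι : Type*} (C : SimpleGraph ι) [Unique ι] : seqTree ≃g joinedTree C where
  toEquiv := (Equiv.uniqueProd (List ℕ+) ι).symm
  map_rel_iff' {u v} := by
    simp [joinedTree]

/-- Induction on the number of copies: a tree with at least two vertices has a leaf, whose copy is
absorbed by that of its neighbour. -/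
theorem nonempty_iso_joinedTree (n : ℕ) : ∀ {ι : Type} [Finite ι] (C : SimpleGraph ι), C.IsTree →
    Nat.card ι = n + 1 → Nonempty (seqTree ≃g joinedTree C) := by
  classical
  induction n with
  | zero =>
    intro ι _ C _ h
    have := (Nat.card_eq_one_iff_unique.1 h)
    have := this.1
    have : Unique ι := @Unique.mk' _ ⟨(Nat.card_eq_one_iff_unique.1 h).2.some⟩ _
    exact ⟨joinedTreeOfUnique C⟩
  | succ n ih =>
    intro ι _ C hC h
    have := Fintype.ofFinite ι
    have : Nontrivial ι := Finite.one_lt_card_iff_nontrivial.1 (by omega)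
    obtain ⟨l, hl⟩ := hC.exists_vert_degree_one_of_nontrivial
    obtain ⟨q, hq, hq'⟩ := SimpleGraph.degree_eq_one_iff_existsUnique_adj.1 hl
    have hl' : ∀ j, C.Adj l j ↔ j = q := fun j => ⟨hq' j, fun h => h ▸ hq⟩
    have hcard : Nat.card {i // i ≠ l} = n + 1 := by
      have := Set.ncard_add_ncard_compl ({l} : Set ι)
      rw [Set.ncard_singleton, h] at this
      change Nat.card (({l}ᶜ : Set ι) : Type) = n + 1
      rw [Nat.card_coe_set_eq]
      omega
    obtain ⟨e⟩ := ih (C.comap (Subtype.val : {i // i ≠ l} → ι))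
      ⟨hC.1.induce_compl_singleton_of_degree_eq_one hl, hC.2.induce _⟩ hcard
    exact ⟨e.trans (RelIso.symm ⟨Equiv.ofBijective _ (absorbLeaf_bijective l q hq.ne'),
      fun {v w} => absorbLeaf_adj l q hq.ne' hl' v w⟩)⟩

theorem nonempty_seqTree_iso_tree {C : SimpleGraph Piece} (hC : C.IsTree) :
    Nonempty (seqTree ≃g tree C) := by
  have := hC.1.nonempty
  obtain ⟨n, hn⟩ := Nat.exists_eq_succ_of_ne_zero (Nat.card_pos (α := Piece)).ne'
  -- For `ι = Piece` the graphs `joinedTree C` and `tree C` agree by definition.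
  exact nonempty_iso_joinedTree n C hC hn

/-- A cell can be left only through its root, the vertex with parameter `[]`. -/
theorem Cell.vertex_adj_mem {C : SimpleGraph Piece} (ν : Cell) {u : List ℕ+} (hu : u ≠ [])
    {v : Piece × List ℕ+} (h : (tree C).Adj (ν.vertex u) v) : v ∈ Set.range ν.vertex := by
  rcases h with ⟨h1, s, h | h⟩ | ⟨h, -, -⟩
  · refine ⟨u ++ [s], Prod.ext_iff.2 ⟨h1, ?_⟩⟩
    rw [h]
    simp [Cell.vertex, shiftHeadList_append _ hu]
  · obtain ⟨u', a, rfl⟩ := List.eq_nil_or_concat' u |>.resolve_left hu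
    refine ⟨u', Prod.ext_iff.2 ⟨h1, ?_⟩⟩
    rcases eq_or_ne u' [] with rfl | hu'
    · have := (List.append_inj' h rfl).1
      simpa [Cell.vertex, shiftHeadList] using this
    · simp only [Cell.vertex, shiftHeadList_append _ hu', ← List.append_assoc] at h
      exact (List.append_inj' h rfl).1
  · simp [Cell.vertex, shiftHeadList_eq_nil, hu] at h

theorem Cell.finite_edges (C : SimpleGraph Piece) (ν : Cell) :
    {e : Sym2 (Piece × List ℕ+) | ∃ a ∈ Set.range ν.vertex, ∃ b ∉ Set.range ν.vertex,
      (tree C).Adj a b ∧ e = s(a, b)}.Finite := by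
  -- Candidates for the outer neighbours of the root: the children excluded by the shift, the
  -- parent, and the initial points of the copies. The list may be too large, which does no harm.
  let B : Set (Piece × List ℕ+) := ((fun s : ℕ+ => (ν.piece, ν.word ++ [s])) ''
    {s | (s : ℕ) ≤ ν.shift}) ∪ {(ν.piece, ν.word.dropLast)} ∪ Set.range fun q => (q, [])
  have hfin : {s : ℕ+ | (s : ℕ) ≤ ν.shift}.Finite :=
    Set.Finite.preimage PNat.coe_injective.injOn (Set.finite_Iic ν.shift)
  have hB : B.Finite := ((hfin.image _).union (Set.finite_singleton _)).union (Set.finite_range _)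
  refine (hB.image fun b => s((ν.piece, ν.word), b)).subset ?_
  rintro e ⟨_, ⟨u, rfl⟩, b, hb, hab, rfl⟩
  obtain rfl : u = [] := by
    by_contra hu
    exact hb (ν.vertex_adj_mem hu hab)
  have h0 : ν.vertex [] = (ν.piece, ν.word) := by simp [Cell.vertex, shiftHeadList]
  refine ⟨b, ?_, by rw [h0]⟩
  rw [h0] at hab
  rcases hab with ⟨h1, s, h | h⟩ | ⟨-, h, -⟩
  · refine Or.inl (Or.inl ⟨s, ?_, Prod.ext_iff.2 ⟨h1, h.symm⟩⟩)
    by_contra hs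
    have hs' : ν.shift < (s : ℕ) := not_le.1 hs
    obtain ⟨b, rfl⟩ := exists_addNat_eq hs'
    exact hb ⟨[b], Prod.ext_iff.2 ⟨h1, h.symm⟩⟩
  · refine Or.inl (Or.inr (Prod.ext_iff.2 ⟨h1.symm, ?_⟩))
    simp only at h
    rw [h, List.dropLast_concat]
  · exact Or.inr ⟨b.1, Prod.ext_iff.2 ⟨rfl, h.symm⟩⟩

theorem Cell.isTSubtree {C : SimpleGraph Piece} (hC : C.IsTree) (ν : Cell) :
    IsTSubtree (tree C) (Set.range ν.vertex) := by
  refine ⟨fun h => ?_, ?_, ν.finite_edges C⟩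
  · have key : ∀ q, q = ν.piece := fun q => by
      obtain ⟨u, hu⟩ := h.symm ▸ Set.mem_univ ((q, []) : Piece × List ℕ+)
      exact (congrArg Prod.fst hu).symm
    have := (key .posInner).trans (key .posOuter).symm
    cases this
  · obtain ⟨e⟩ := nonempty_seqTree_iso_tree hC
    exact ⟨(ν.embedding C).isoInduceRange.symm.trans e⟩

/-! ### Spheromorphisms from partitions into cells -/

/-- A family of cells whose sets of ends form a partition of the boundary. -/
def IsPartition {ι : Type*} (c : ι → Cell) : Prop :=
  ∀ p s, ∃! i, (c i).piece = p ∧ s ∈ Set.range (c i).ray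

theorem appendSeq_append (w v : List ℕ+) (s : ℕ → ℕ+) :
    appendSeq (w ++ v) s = appendSeq w (appendSeq v s) := by
  induction w with
  | nil => rfl
  | cons a w ih =>
    funext n
    cases n with
    | zero => rfl
    | succ n => simp only [List.cons_append, appendSeq, ih]

theorem appendSeq_length_add (w : List ℕ+) (s : ℕ → ℕ+) (n : ℕ) :
    appendSeq w s (w.length + n) = s n := by
  induction w with
  | nil => simp [appendSeq]
  | cons a w ih => rw [List.length_cons, add_right_comm, appendSeq, ih]

theorem appendSeq_mem {w : List ℕ+} {s : ℕ → ℕ+} {n : ℕ} (h : n < w.length) :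
    appendSeq w s n ∈ w := by
  induction w generalizing n with
  | nil => simp at h
  | cons a w ih =>
    cases n with
    | zero => simp [appendSeq]
    | succ n => exact List.mem_cons_of_mem _ (ih (by simpa using h))

theorem appendSeq_eq_appendSeq {w v : List ℕ+} {s t : ℕ → ℕ+} (h : appendSeq w s = appendSeq v t)
    (hl : w.length ≤ v.length) : ∃ u, v = w ++ u ∧ s = appendSeq u t := by
  induction w generalizing v with
  | nil => exact ⟨v, rfl, by funext n; exact congrFun h n⟩
  | cons a w ih =>
    cases v with
    | nil => simp at hl
    | cons b v =>
      have h0 : a = b := congrFun h 0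
      obtain ⟨u, rfl, hu⟩ := ih (v := v) (funext fun n => congrFun h (n + 1)) (by simpa using hl)
      exact ⟨u, by rw [h0]; rfl, hu⟩

theorem shiftHead_appendSeq (m : ℕ) {u : List ℕ+} (hu : u ≠ []) (s : ℕ → ℕ+) :
    shiftHead m (appendSeq u s) = appendSeq (shiftHeadList m u) s := by
  cases u with
  | nil => exact absurd rfl hu
  | cons a u =>
    funext n
    cases n <;> rfl

/-- All sequences continuing a vertex of a cell by a large term are ends of the cell. -/
theorem Cell.exists_large_mem_range_ray (ν : Cell) {p : Piece} {x : List ℕ+}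
    (h : (p, x) ∈ Set.range ν.vertex) :
    ν.piece = p ∧ ∀ (k : ℕ+) (s : ℕ → ℕ+), ν.shift < k →
      appendSeq (x ++ [k]) s ∈ Set.range ν.ray := by
  obtain ⟨u, hu⟩ := h
  obtain ⟨rfl, rfl⟩ := Prod.ext_iff.1 hu
  refine ⟨rfl, fun k s hk => ?_⟩
  rcases eq_or_ne u [] with rfl | hne
  · obtain ⟨b, rfl⟩ := exists_addNat_eq hk
    refine ⟨appendSeq [b] s, ?_⟩
    rw [Cell.ray, shiftHead_appendSeq _ (by simp), ← appendSeq_append]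
    simp [vertex, shiftHeadList]
  · refine ⟨appendSeq (u ++ [k]) s, ?_⟩
    rw [Cell.ray, shiftHead_appendSeq _ (by simp), ← appendSeq_append,
      shiftHeadList_append _ hne]
    simp [vertex]

/-- If an end of a cell continues the vertex `x` by a large term, then `x` belongs to the cell. -/
theorem Cell.mem_range_vertex (ν : Cell) {x : List ℕ+} {k : ℕ+} {s : ℕ → ℕ+}
    (h : appendSeq (x ++ [k]) s ∈ Set.range ν.ray) (hk : k ∉ ν.word) :
    (ν.piece, x) ∈ Set.range ν.vertex := by
  obtain ⟨t, ht⟩ := h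
  rw [Cell.ray, appendSeq_append] at ht
  rcases le_or_gt ν.word.length x.length with hl | hl
  · obtain ⟨u, rfl, hu⟩ := appendSeq_eq_appendSeq ht hl
    rcases u with _ | ⟨a, u⟩
    · exact ⟨[], by simp [vertex, shiftHeadList]⟩
    · have h0 : addNat (t 0) ν.shift = a := congrFun hu 0
      exact ⟨t 0 :: u, by simp [vertex, shiftHeadList, h0]⟩
  -- If `x` is shorter than the word of the cell, then `k` sits at a position inside that word,
  -- which is excluded.
  · exfalso
    apply hk
    have h1 := congrFun ht x.length
    have h2 := appendSeq_length_add x (appendSeq [k] s) 0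
    rw [add_zero] at h2
    rw [h2] at h1
    have h3 : appendSeq [k] s 0 = k := rfl
    rw [← h3, ← h1]
    exact appendSeq_mem hl

theorem exists_pnat_gt (n : ℕ) : ∃ k : ℕ+, n < k := ⟨⟨n + 1, n.succ_pos⟩, n.lt_succ_self⟩

/-- Vertices are tested by ends: for all large `k`, a vertex `x` lies in a cell exactly when the
ends through `x` followed by `k` do. Finitely many cells allow a common choice of `k`, so the
partition of ends passes to vertices. -/
theorem IsPartition.isCoveringForest {C : SimpleGraph Piece} (hC : C.IsTree) {k : ℕ}
    {c : Fin k → Cell} (hc : IsPartition c) :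
    IsCoveringForest (tree C) fun j => Set.range (c j).vertex := by
  have hU : ⋃ j, Set.range (c j).vertex = Set.univ := by
    refine Set.eq_univ_of_forall ?_
    rintro ⟨p, x⟩
    have hfin : (⋃ j, {a : ℕ+ | a ∈ (c j).word}).Finite :=
      Set.finite_iUnion fun j => List.finite_toSet _
    obtain ⟨a, ha⟩ := hfin.exists_notMem
    obtain ⟨j, ⟨rfl, hj⟩, -⟩ := hc p (appendSeq (x ++ [a]) fun _ => 1)
    exact Set.mem_iUnion.2 ⟨j, (c j).mem_range_vertex hj
      fun h => ha (Set.mem_iUnion.2 ⟨j, h⟩)⟩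
  refine ⟨fun j => (c j).isTSubtree hC, ?_, hU, ?_⟩
  · intro i j hij
    refine Set.disjoint_left.2 ?_
    rintro ⟨p, x⟩ hi hj
    obtain ⟨hi1, hi2⟩ := (c i).exists_large_mem_range_ray hi
    obtain ⟨hj1, hj2⟩ := (c j).exists_large_mem_range_ray hj
    obtain ⟨a, ha⟩ := exists_pnat_gt ((c i).shift + (c j).shift)
    exact hij ((hc p (appendSeq (x ++ [a]) fun _ => 1)).unique ⟨hi1, hi2 a _ (by omega)⟩
      ⟨hj1, hj2 a _ (by omega)⟩)
  · refine (Set.finite_iUnion fun j => (c j).finite_edges C).subset ?_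
    intro e
    induction e using Sym2.ind with
    | _ a b =>
      rintro ⟨hab, h⟩
      obtain ⟨j, hj⟩ := Set.mem_iUnion.1 (hU.symm ▸ Set.mem_univ a)
      refine Set.mem_iUnion.2 ⟨j, a, hj, b, fun hb => h j ?_, hab, rfl⟩
      intro v hv
      rcases Sym2.mem_iff.1 hv with rfl | rfl
      exacts [hj, hb]

/-- A transformation of the boundary which maps the cells of a partition to cells in the standard
way is a spheromorphism. -/
theorem mem_Hier_of_isPartition {C : SimpleGraph Piece} (hC : C.IsTree) {ι : Type*} [Finite ι]
    {c d : ι → Cell} (hc : IsPartition c) {Φ : Equiv.Perm (Boundary (tree C))}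
    (hΦ : ∀ i s, Φ (endOf (wayOf C (c i).piece ((c i).ray s))) =
      endOf (wayOf C (d i).piece ((d i).ray s))) : Φ ∈ Hier (tree C) := by
  -- The target cells need no separate hypothesis: the bijection `Φ` transports the partition.
  have hd : IsPartition d := by
    intro p s
    obtain ⟨a, ha⟩ := Quotient.exists_rep (Φ.symm (endOf (wayOf C p s)))
    obtain ⟨q, t, h⟩ := exists_eventually_eq_wayOf a
    have hqt : Φ (endOf (wayOf C q t)) = endOf (wayOf C p s) := by
      rw [← endOf_eq_of_eventually_eq h, endOf, ha, Equiv.apply_symm_apply]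
    obtain ⟨i, ⟨rfl, r, rfl⟩, hi'⟩ := hc q t
    refine ⟨i, ?_, ?_⟩
    · rw [hΦ] at hqt
      obtain ⟨h1, h2⟩ := endOf_wayOf_injective hqt
      exact ⟨h1, r, h2⟩
    · rintro j ⟨rfl, r', rfl⟩
      rw [← hΦ j r'] at hqt
      obtain ⟨h1, h2⟩ := endOf_wayOf_injective (Φ.injective hqt)
      exact hi' j ⟨h1.symm, r', h2.symm⟩
  obtain ⟨k, ⟨e⟩⟩ := Finite.exists_equiv_fin ι
  have hcomp : ∀ f : ι → Cell, IsPartition f → IsPartition fun j : Fin k => f (e.symm j) := by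
    intro f hf p s
    obtain ⟨i, hi, hi'⟩ := hf p s
    refine ⟨e i, by simpa using hi, fun j hj => ?_⟩
    rw [← hi' _ hj, Equiv.apply_symm_apply]
  -- Source and target cells are identified through their common parametrization by `seqTree`.
  refine ⟨k, _, _, fun j => ((c (e.symm j)).embedding C).isoInduceRange.symm.trans
    ((d (e.symm j)).embedding C).isoInduceRange, (hcomp c hc).isCoveringForest hC,
    (hcomp d hd).isCoveringForest hC, fun j a => ?_⟩
  let i := e.symm j
  let b : Way seqTree := a.map ((c i).embedding C).isoInduceRange.symm.toEmbedding
  obtain ⟨s, m, n, h⟩ := exists_eventually_eq_initialSegment b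
  have h1 : a.map (SimpleGraph.Embedding.induce (Set.range ((c i).embedding C))) =
      b.map ((c i).embedding C) := by
    have : ∀ x : Set.range ((c i).embedding C), (x : Piece × List ℕ+) =
        (c i).embedding C (((c i).embedding C).isoInduceRange.symm x) := fun x =>
      congrArg Subtype.val (((c i).embedding C).isoInduceRange.apply_symm_apply x).symm
    simp only [Way.map, Way.mk.injEq]
    funext n
    exact this _
  refine Eq.trans (congrArg (fun a => Φ (endOf a)) h1) ?_
  refine Eq.trans (congrArg Φ (endOf_map_embedding C (c i) h)) ?_
  rw [hΦ]
  exact (endOf_map_embedding C (d i) h).symm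

/-! ### Cells and linear fractional transformations -/

/-- With determinant `±1` no integer lies strictly between `a / c` and `b / d`, so the smaller of
the two integer quotients serves both. A remainder may equal its divisor, when the other fraction is
the next integer. -/
theorem exists_common_quotient {a b c d : ℕ} (hc : 0 < c) (hd : 0 < d) (hca : c ≤ a) (hdb : d ≤ b)
    (h : a * d = b * c + 1 ∨ b * c = a * d + 1) :
    ∃ n a' b', 0 < n ∧ a = n * c + a' ∧ b = n * d + b' ∧ a' ≤ c ∧ b' ≤ d := by
  have key : ∀ {a b c d : ℕ}, 0 < c → 0 < d → c ≤ a → a / c ≤ b / d →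
      (a * d = b * c + 1 ∨ b * c = a * d + 1) →
      ∃ n a' b', 0 < n ∧ a = n * c + a' ∧ b = n * d + b' ∧ a' ≤ c ∧ b' ≤ d := by
    intro a b c d hc hd hca hle h
    have h1 : a / c * c ≤ a := Nat.div_mul_le_self a c
    have h2 : a / c * d ≤ b := (Nat.mul_le_mul_right d hle).trans (Nat.div_mul_le_self b d)
    have h3 : a < (a / c + 1) * c := by
      rw [mul_comm]
      exact Nat.lt_mul_div_succ a hc
    refine ⟨a / c, a - a / c * c, b - a / c * d, Nat.div_pos hca hc, by omega, by omega, ?_, ?_⟩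
    · rw [add_mul, one_mul] at h3
      omega
    · by_contra hlt
      have h4 : (a / c + 1) * d + 1 ≤ b := by
        rw [add_mul, one_mul]
        omega
      generalize a / c = n at *
      have h5 := Nat.mul_le_mul_right c h4
      have h6 := Nat.mul_le_mul_right d h3
      rcases h with h | h <;> nlinarith
  rcases le_total (a / c) (b / d) with hle | hle
  · exact key hc hd hca hle h
  · obtain ⟨n, b', a', hn, hb, ha, hb', ha'⟩ := key hd hc hdb hle h.symm
    exact ⟨n, a', b', hn, ha, hb, ha', hb'⟩

/-- A linear fractional transformation which maps `(0, ∞)` into `(1, ∞)` is, up to the inversion of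
the variable, a continued fraction. -/
theorem exists_contFrac_eq (N : ℕ) : ∀ {a b c d : ℕ}, c + d ≤ N → c ≤ a → d ≤ b →
    (a * d = b * c + 1 ∨ b * c = a * d + 1) → ∃ (w : List ℕ+) (m : ℕ),
      (∀ y : ℝ, 0 < y → (a * y + b) / (c * y + d) = contFrac w (y + 1 + m)) ∨
      (∀ y : ℝ, 0 < y → (a * y + b) / (c * y + d) = contFrac w (y⁻¹ + 1 + m)) := by
  induction N with
  | zero =>
    intro a b c d hN _ _ h
    obtain ⟨rfl, rfl⟩ : c = 0 ∧ d = 0 := by omega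
    simp at h
  | succ N ih =>
    intro a b c d hN hca hdb h
    rcases Nat.eq_zero_or_pos c with rfl | hc
    · obtain ⟨rfl, rfl⟩ : a = 1 ∧ d = 1 := by
        rcases h with h | h
        · exact ⟨Nat.eq_one_of_mul_eq_one_right (by simpa using h),
            Nat.eq_one_of_mul_eq_one_left (by simpa using h)⟩
        · omega
      obtain ⟨m, rfl⟩ := Nat.exists_eq_add_of_le' hdb
      refine ⟨[], m, Or.inl fun y hy => ?_⟩
      simp only [contFrac]
      push_cast
      ring
    rcases Nat.eq_zero_or_pos d with rfl | hd
    · obtain ⟨rfl, rfl⟩ : b = 1 ∧ c = 1 := by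
        rcases h with h | h
        · omega
        · exact ⟨Nat.eq_one_of_mul_eq_one_right (by simpa using h),
            Nat.eq_one_of_mul_eq_one_left (by simpa using h)⟩
      obtain ⟨m, rfl⟩ := Nat.exists_eq_add_of_le' hca
      refine ⟨[], m, Or.inr fun y hy => ?_⟩
      simp only [contFrac]
      push_cast
      field_simp
      ring
    obtain ⟨n, a', b', hn, rfl, rfl, ha', hb'⟩ := exists_common_quotient hc hd hca hdb h
    have hdet : c * b' = d * a' + 1 ∨ d * a' = c * b' + 1 := by
      rcases h with h | h
      · right; nlinarith
      · left; nlinarith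
    have hpos : 0 < a' ∨ 0 < b' := by
      by_contra! h0
      obtain ⟨rfl, rfl⟩ : a' = 0 ∧ b' = 0 := by omega
      simp at hdet
    -- The sum of the denominator coefficients drops: equality in both remainder bounds would make
    -- the determinant `0`.
    have hlt : a' + b' ≤ N := by
      by_contra hlt
      obtain ⟨rfl, rfl⟩ : a' = c ∧ b' = d := by omega
      rcases hdet with h | h <;> nlinarith
    have e : ∀ y : ℝ, 0 < y → (((n * c + a' : ℕ) : ℝ) * y + ((n * d + b' : ℕ) : ℝ)) / (c * y + d) =
        n + ((c * y + d) / (a' * y + b'))⁻¹ := by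
      intro y hy
      have h1 : (0 : ℝ) < c * y + d := by positivity
      have h2 : (0 : ℝ) < a' * y + b' := by rcases hpos with h | h <;> positivity
      push_cast
      field_simp
      ring
    obtain ⟨w, m, hw⟩ := ih hlt ha' hb' hdet
    refine ⟨⟨n, hn⟩ :: w, m, hw.imp (fun hw y hy => ?_) fun hw y hy => ?_⟩
    · rw [e y hy, hw y hy]
      rfl
    · rw [e y hy, hw y hy]
      rfl

theorem exists_contFrac_eq_int {a b c d : ℤ} (hc : 0 ≤ c) (hd : 0 ≤ d) (hca : c ≤ a) (hdb : d ≤ b)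
    (h : a * d - b * c = 1 ∨ a * d - b * c = -1) : ∃ (w : List ℕ+) (m : ℕ),
      (∀ y : ℝ, 0 < y → (a * y + b) / (c * y + d) = contFrac w (y + 1 + m)) ∨
      (∀ y : ℝ, 0 < y → (a * y + b) / (c * y + d) = contFrac w (y⁻¹ + 1 + m)) := by
  lift c to ℕ using hc
  lift d to ℕ using hd
  lift a to ℕ using (by omega)
  lift b to ℕ using (by omega)
  have := exists_contFrac_eq (c + d) (a := a) (b := b) le_rfl (by omega) (by omega) (by
    rcases h with h | h
    · left; zify; linarith
    · right; zify; linarith)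
  simpa only [Int.cast_natCast] using this

/-- Otherwise `-b / a` would be a positive zero. This turns the avoidance of `∞, 0, 1, -1` into
inequalities between coefficients. -/
theorem same_sign_of_ne_zero {a b : ℤ} (h : ∀ y : ℝ, 0 < y → a * y + b ≠ 0) :
    (0 ≤ a ∧ 0 ≤ b) ∨ (a ≤ 0 ∧ b ≤ 0) := by
  by_contra! hab
  obtain ⟨h1, h2⟩ := hab
  have ha : a ≠ 0 := by
    rintro rfl
    have := h1 le_rfl
    have := h2 le_rfl
    omega
  have ha' : (a : ℝ) ≠ 0 := by exact_mod_cast ha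
  refine h (-b / a) ?_ (by field_simp; ring)
  rcases lt_or_gt_of_ne ha with ha | ha
  · have h3 : (0 : ℝ) < b := by exact_mod_cast h2 ha.le
    have h4 : (a : ℝ) < 0 := by exact_mod_cast ha
    exact div_pos_of_neg_of_neg (by linarith) h4
  · have h3 : (b : ℝ) < 0 := by exact_mod_cast h1 ha.le
    have h4 : (0 : ℝ) < a := by exact_mod_cast ha
    exact div_pos (by linarith) h4

/-- The signs of numerator, numerator minus denominator and numerator plus denominator single out
the piece; a negation or inversion then reduces to values above `1`. -/
theorem exists_chart_eq_of_nonneg {a b c d : ℤ} (hc : 0 ≤ c) (hd : 0 ≤ d)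
    (h : a * d - b * c = 1 ∨ a * d - b * c = -1) (h0 : ∀ y : ℝ, 0 < y → a * y + b ≠ 0)
    (h1 : ∀ y : ℝ, 0 < y → a * y + b ≠ c * y + d)
    (h2 : ∀ y : ℝ, 0 < y → a * y + b ≠ -(c * y + d)) :
    ∃ ν : Cell, (∀ y : ℝ, 0 < y → (a * y + b) / (c * y + d) = ν.chart y) ∨
      ∀ y : ℝ, 0 < y → (a * y + b) / (c * y + d) = ν.chart y⁻¹ := by
  have h1' := same_sign_of_ne_zero (a := a - c) (b := b - d) fun y hy h => h1 y hy (by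
    push_cast at h; linarith)
  have h2' := same_sign_of_ne_zero (a := a + c) (b := b + d) fun y hy h => h2 y hy (by
    push_cast at h; linarith)
  rcases same_sign_of_ne_zero h0 with ⟨ha, hb⟩ | ⟨ha, hb⟩
  · rcases h1' with ⟨h3, h4⟩ | ⟨h3, h4⟩
    · obtain ⟨w, m, hw⟩ := exists_contFrac_eq_int hc hd (by linarith) (by linarith) h
      exact ⟨⟨.posOuter, w, m⟩, hw⟩
    · obtain ⟨w, m, hw⟩ := exists_contFrac_eq_int ha hb (a := c) (b := d) (by linarith)
        (by linarith) (by
          rcases h with h | h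
          · right; linarith
          · left; linarith)
      refine ⟨⟨.posInner, w, m⟩, hw.imp (fun hw y hy => ?_) fun hw y hy => ?_⟩ <;>
      · rw [← inv_div, hw y hy]
        rfl
  · rcases h2' with ⟨h3, h4⟩ | ⟨h3, h4⟩
    · obtain ⟨w, m, hw⟩ := exists_contFrac_eq_int (neg_nonneg.2 ha) (neg_nonneg.2 hb) (a := c)
        (b := d) (by linarith) (by linarith) (by
          rcases h with h | h
          · left; linarith
          · right; linarith)
      have e : ∀ y : ℝ, (a * y + b) / (c * y + d) =
          -((c * y + d) / ((-a : ℤ) * y + (-b : ℤ)))⁻¹ := fun y => by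
        rw [inv_div, ← neg_div]
        push_cast
        congr 1
        ring
      refine ⟨⟨.negInner, w, m⟩, hw.imp (fun hw y hy => ?_) fun hw y hy => ?_⟩ <;>
      · rw [e, hw y hy]
        rfl
    · obtain ⟨w, m, hw⟩ := exists_contFrac_eq_int hc hd (a := -a)
        (b := -b) (by linarith) (by linarith) (by
          rcases h with h | h
          · right; linarith
          · left; linarith)
      have e : ∀ y : ℝ, (a * y + b) / (c * y + d) =
          -(((-a : ℤ) * y + (-b : ℤ)) / (c * y + d)) := fun y => by
        rw [← neg_div]
        push_cast
        congr 1
        ring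
      refine ⟨⟨.negOuter, w, m⟩, hw.imp (fun hw y hy => ?_) fun hw y hy => ?_⟩ <;>
      · rw [e, hw y hy]
        rfl

/-- A linear fractional transformation which maps `(0, ∞)` into one of the four pieces is, up to
the inversion of the variable, the chart of a cell. -/
theorem exists_chart_eq {a b c d : ℤ} (h : a * d - b * c = 1 ∨ a * d - b * c = -1)
    (hi : ∀ y : ℝ, 0 < y → c * y + d ≠ 0) (h0 : ∀ y : ℝ, 0 < y → a * y + b ≠ 0)
    (h1 : ∀ y : ℝ, 0 < y → a * y + b ≠ c * y + d)
    (h2 : ∀ y : ℝ, 0 < y → a * y + b ≠ -(c * y + d)) :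
    ∃ ν : Cell, (∀ y : ℝ, 0 < y → (a * y + b) / (c * y + d) = ν.chart y) ∨
      ∀ y : ℝ, 0 < y → (a * y + b) / (c * y + d) = ν.chart y⁻¹ := by
  rcases same_sign_of_ne_zero hi with ⟨hc, hd⟩ | ⟨hc, hd⟩
  · exact exists_chart_eq_of_nonneg hc hd h h0 h1 h2
  · obtain ⟨ν, hν⟩ := exists_chart_eq_of_nonneg (a := -a) (b := -b) (neg_nonneg.2 hc)
      (neg_nonneg.2 hd) (by simpa using h)
      (fun y hy h => h0 y hy (by push_cast at h; linarith))
      (fun y hy h => h1 y hy (by push_cast at h; linarith))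
      (fun y hy h => h2 y hy (by push_cast at h; linarith))
    have e : ∀ y : ℝ, (((-a : ℤ) : ℝ) * y + (-b : ℤ)) / ((-c : ℤ) * y + (-d : ℤ)) =
        (a * y + b) / (c * y + d) := fun y => by
      rw [← neg_div_neg_eq]
      push_cast
      congr 1 <;> ring
    simp only [e] at hν
    exact ⟨ν, hν⟩

theorem exists_contFrac_eq_div (w : List ℕ+) (m : ℕ) : ∃ a b c d : ℤ,
    (a * d - b * c = 1 ∨ a * d - b * c = -1) ∧ ∀ y : ℝ, 0 < y → 0 < a * y + b ∧ 0 < c * y + d ∧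
      contFrac w (y + 1 + m) = (a * y + b) / (c * y + d) := by
  induction w with
  | nil =>
    refine ⟨1, 1 + m, 0, 1, by simp, fun y hy => ?_⟩
    push_cast
    refine ⟨by positivity, by norm_num, ?_⟩
    simp only [contFrac]
    ring
  | cons n w ih =>
    obtain ⟨a, b, c, d, h, hw⟩ := ih
    refine ⟨n * a + c, n * b + d, a, b, ?_, fun y hy => ?_⟩
    · rcases h with h | h
      · right; linarith
      · left; linarith
    · obtain ⟨h1, h2, h3⟩ := hw y hy
      have e : ((n * a + c : ℤ) : ℝ) * y + ((n * b + d : ℤ) : ℝ) =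
          n * (a * y + b) + (c * y + d) := by
        push_cast
        ring
      rw [e, contFrac, h3]
      refine ⟨by positivity, h1, ?_⟩
      field_simp

/-- The chart of a cell is a linear fractional transformation. -/
theorem Cell.exists_chart_eq_div (ν : Cell) : ∃ a b c d : ℤ,
    (a * d - b * c = 1 ∨ a * d - b * c = -1) ∧ ∀ y : ℝ, 0 < y → 0 < c * y + d ∧
      ν.chart y = (a * y + b) / (c * y + d) := by
  obtain ⟨p, w, m⟩ := ν
  obtain ⟨a, b, c, d, h, hw⟩ := exists_contFrac_eq_div w m
  cases p
  · refine ⟨-a, -b, c, d, ?_, fun y hy => ⟨(hw y hy).2.1, ?_⟩⟩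
    · rcases h with h | h
      · right; linarith
      · left; linarith
    · simp only [chart, pieceMap]
      rw [(hw y hy).2.2, ← neg_div]
      push_cast
      congr 1
      ring
  · refine ⟨-c, -d, a, b, ?_, fun y hy => ⟨(hw y hy).1, ?_⟩⟩
    · rcases h with h | h
      · left; linarith
      · right; linarith
    · simp only [chart, pieceMap]
      rw [(hw y hy).2.2, inv_div, ← neg_div]
      push_cast
      congr 1
      ring
  · refine ⟨c, d, a, b, ?_, fun y hy => ⟨(hw y hy).1, ?_⟩⟩
    · rcases h with h | h
      · right; linarith
      · left; linarith
    · simp only [chart, pieceMap]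
      rw [(hw y hy).2.2, inv_div]
  · exact ⟨a, b, c, d, h, fun y hy => (hw y hy).2⟩

theorem Cell.continuousOn_chart (ν : Cell) : ContinuousOn ν.chart (Set.Ioi 0) := by
  obtain ⟨a, b, c, d, -, h⟩ := ν.exists_chart_eq_div
  refine ContinuousOn.congr (f := fun y : ℝ => (a * y + b) / (c * y + d)) ?_
    fun y hy => (h y hy).2
  exact ContinuousOn.div (by fun_prop) (by fun_prop) fun y hy => (h y hy).1.ne'

theorem linFrac_infty (γ : GL (Fin 2) ℤ) : linFrac γ OnePoint.infty =
    if γ 1 0 = 0 then OnePoint.infty else (((γ 0 0 : ℝ) / (γ 1 0 : ℝ) : ℝ) : OnePoint ℝ) := by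
  rw [linFrac, OnePoint.smul_infty_eq_ite]
  simp

theorem linFrac_coe (γ : GL (Fin 2) ℤ) (x : ℝ) : linFrac γ x =
    if (γ 1 0 : ℝ) * x + γ 1 1 = 0 then OnePoint.infty
    else (((γ 0 0 * x + γ 0 1) / (γ 1 0 * x + γ 1 1) : ℝ) : OnePoint ℝ) := by
  rw [linFrac, OnePoint.smul_some_eq_ite]
  simp

theorem det_eq_one_or (γ : GL (Fin 2) ℤ) : γ 0 0 * γ 1 1 - γ 0 1 * γ 1 0 = 1 ∨
    γ 0 0 * γ 1 1 - γ 0 1 * γ 1 0 = -1 := by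
  rw [← Matrix.det_fin_two]
  exact Int.isUnit_iff.1 ((Matrix.isUnit_iff_isUnit_det _).1 γ.isUnit)

/-- A transformation in `PGL₂(ℤ)` which maps a cell into one of the four pieces maps it onto a
cell. -/
theorem Cell.exists_linFrac_chart_eq (ν : Cell) (γ : GL (Fin 2) ℤ)
    (hi : ∀ y : ℝ, 0 < y → linFrac γ (ν.chart y) ≠ OnePoint.infty)
    (h0 : ∀ y : ℝ, 0 < y → linFrac γ (ν.chart y) ≠ ((0 : ℝ) : OnePoint ℝ))
    (h1 : ∀ y : ℝ, 0 < y → linFrac γ (ν.chart y) ≠ ((1 : ℝ) : OnePoint ℝ))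
    (h2 : ∀ y : ℝ, 0 < y → linFrac γ (ν.chart y) ≠ ((-1 : ℝ) : OnePoint ℝ)) :
    ∃ μ : Cell, (∀ y : ℝ, 0 < y → linFrac γ (ν.chart y) = μ.chart y) ∨
      ∀ y : ℝ, 0 < y → linFrac γ (ν.chart y) = μ.chart y⁻¹ := by
  obtain ⟨a, b, c, d, hdet, h⟩ := ν.exists_chart_eq_div
  set A := γ 0 0 * a + γ 0 1 * c with hA
  set B := γ 0 0 * b + γ 0 1 * d with hB
  set C := γ 1 0 * a + γ 1 1 * c with hC
  set D := γ 1 0 * b + γ 1 1 * d with hD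
  have hnum : ∀ y : ℝ, 0 < y → (γ 0 0 : ℝ) * ν.chart y + γ 0 1 = (A * y + B) / (c * y + d) := by
    intro y hy
    obtain ⟨hp, he⟩ := h y hy
    rw [he, hA, hB, eq_div_iff hp.ne', add_mul, mul_assoc, div_mul_cancel₀ _ hp.ne']
    push_cast
    ring
  have hden : ∀ y : ℝ, 0 < y → (γ 1 0 : ℝ) * ν.chart y + γ 1 1 = (C * y + D) / (c * y + d) := by
    intro y hy
    obtain ⟨hp, he⟩ := h y hy
    rw [he, hC, hD, eq_div_iff hp.ne', add_mul, mul_assoc, div_mul_cancel₀ _ hp.ne']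
    push_cast
    ring
  have hi' : ∀ y : ℝ, 0 < y → (C : ℝ) * y + D ≠ 0 := by
    intro y hy h'
    refine hi y hy ?_
    rw [linFrac_coe, hden y hy, h', zero_div, if_pos rfl]
  have hval : ∀ y : ℝ, 0 < y → linFrac γ (ν.chart y) =
      (((A * y + B) / (C * y + D) : ℝ) : OnePoint ℝ) := by
    intro y hy
    have hp := (h y hy).1.ne'
    rw [linFrac_coe, hden y hy, hnum y hy, if_neg (div_ne_zero (hi' y hy) hp),
      div_div_div_cancel_right₀ hp]
  have hdet' : A * D - B * C = 1 ∨ A * D - B * C = -1 := by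
    have e : A * D - B * C = (γ 0 0 * γ 1 1 - γ 0 1 * γ 1 0) * (a * d - b * c) := by
      rw [hA, hB, hC, hD]
      ring
    rw [e]
    rcases det_eq_one_or γ with h | h <;> rcases hdet with h' | h' <;> simp [h, h']
  obtain ⟨μ, hμ⟩ := exists_chart_eq hdet' hi'
    (fun y hy h' => h0 y hy (by rw [hval y hy, h', zero_div]))
    (fun y hy h' => h1 y hy (by rw [hval y hy, h', div_self (hi' y hy)]))
    (fun y hy h' => h2 y hy (by rw [hval y hy, h', neg_div, div_self (hi' y hy)]))
  exact ⟨μ, hμ.imp (fun hμ y hy => by rw [hval y hy, hμ y hy])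
    fun hμ y hy => by rw [hval y hy, hμ y hy]⟩

/-! ### Subdivision of cells -/

/-- The ends of a cell. -/
def Cell.ends (ν : Cell) : Set (Piece × (ℕ → ℕ+)) :=
  {x | ν.piece = x.1 ∧ x.2 ∈ Set.range ν.ray}

/-- The part of a cell which remains when the subtree at the first child is removed. -/
def Cell.rest (ν : Cell) : Cell := ⟨ν.piece, ν.word, ν.shift + 1⟩

/-- The subtree of a cell at the first child of its root. -/
def Cell.child (ν : Cell) : Cell := ⟨ν.piece, ν.word ++ [addNat 1 ν.shift], 0⟩

theorem contFrac_injective (w : List ℕ+) : Function.Injective (contFrac w) := by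
  induction w with
  | nil => exact fun _ _ h => h
  | cons n w ih => exact fun x y h => ih (inv_injective (add_left_cancel h))

theorem pieceMap_injective (p : Piece) : Function.Injective (pieceMap p) := by
  intro x y h
  cases p <;> simpa [pieceMap] using h

theorem Cell.chart_injective (ν : Cell) : Function.Injective ν.chart := by
  intro x y h
  simpa using contFrac_injective _ (pieceMap_injective _ h)

/-- The part `rest` is the range `y > 1` of the parameter, and `child` is the range `y < 1`. -/
theorem Cell.chart_rest (ν : Cell) (y : ℝ) : ν.rest.chart y = ν.chart (y + 1) := by
  simp only [chart, rest]
  push_cast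
  congr 2
  ring

theorem Cell.chart_child (ν : Cell) (y : ℝ) : ν.child.chart y = ν.chart (y + 1)⁻¹ := by
  simp only [chart, child, contFrac_append, contFrac, coe_addNat]
  push_cast
  congr 2
  rw [add_zero]
  ring

theorem Cell.ends_rest_subset (ν : Cell) : ν.rest.ends ⊆ ν.ends := by
  rintro ⟨p, _⟩ ⟨h, s, rfl⟩
  refine ⟨h, shiftHead 1 s, ?_⟩
  refine congrArg (appendSeq ν.word) ?_
  funext n
  cases n with
  | zero => exact PNat.eq (by simp only [shiftHead, coe_addNat, rest]; ring)
  | succ n => rfl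

theorem Cell.ray_child (ν : Cell) (s : ℕ → ℕ+) : ν.child.ray s =
    ν.ray (appendSeq [1] s) := by
  have h : shiftHead 0 s = s := by
    funext n
    cases n <;> rfl
  simp only [ray, child, appendSeq_append, h]
  congr 1
  funext n
  cases n <;> rfl

theorem Cell.ends_child_subset (ν : Cell) : ν.child.ends ⊆ ν.ends := by
  rintro ⟨p, _⟩ ⟨h, s, rfl⟩
  exact ⟨h, _, (ν.ray_child s).symm⟩

theorem appendSeq_injective (w : List ℕ+) : Function.Injective (appendSeq w) := fun s t h =>
  funext fun n => by rw [← appendSeq_length_add w s, h, appendSeq_length_add]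

/-- The first term of the parameter sequence separates the parts: it is `1` on `child` and at least
`2` on `rest`. -/
theorem Cell.ends_disjoint (ν : Cell) : Disjoint ν.rest.ends ν.child.ends := by
  refine Set.disjoint_left.2 ?_
  rintro ⟨p, _⟩ ⟨-, s, rfl⟩ ⟨-, t, ht⟩
  rw [ray_child] at ht
  have h := congrArg PNat.val (congrFun (appendSeq_injective _ ht) 0)
  simp only [shiftHead, coe_addNat, rest, appendSeq, PNat.val_ofNat] at h
  have := (s 0).pos
  omega

theorem Cell.ends_subset_union (ν : Cell) : ν.ends ⊆ ν.rest.ends ∪ ν.child.ends := by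
  rintro ⟨p, _⟩ ⟨h, s, rfl⟩
  by_cases h1 : s 0 = 1
  · refine Or.inr ⟨h, fun n => s (n + 1), ?_⟩
    rw [ray_child]
    congr 1
    funext n
    cases n with
    | zero => exact h1.symm
    | succ n => rfl
  · have h2 : 1 < (s 0 : ℕ) := by
      have := (s 0).pos
      have : (s 0 : ℕ) ≠ 1 := fun h => h1 (PNat.eq h)
      omega
    obtain ⟨b, hb⟩ := exists_addNat_eq h2
    refine Or.inl ⟨h, appendSeq [b] fun n => s (n + 1), ?_⟩
    refine congrArg (appendSeq ν.word) ?_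
    funext n
    cases n with
    | zero =>
      refine PNat.eq ?_
      simp only [shiftHead, ← hb, coe_addNat, rest, appendSeq]
      ring
    | succ n => rfl

/-- The cell `ν` has a finite subdivision into cells each of which is mapped by `Φ` to a cell in
the standard way. -/
def IsDecomposable {C : SimpleGraph Piece} (Φ : Equiv.Perm (Boundary (tree C))) (ν : Cell) :
    Prop :=
  ∃ (ι : Type) (_ : Finite ι) (c d : ι → Cell), (∀ i, (c i).ends ⊆ ν.ends) ∧
    (∀ x ∈ ν.ends, ∃! i, x ∈ (c i).ends) ∧
    ∀ i s, Φ (endOf (wayOf C (c i).piece ((c i).ray s))) =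
      endOf (wayOf C (d i).piece ((d i).ray s))

variable {C : SimpleGraph Piece} {Φ : Equiv.Perm (Boundary (tree C))}

theorem IsDecomposable.of_ray {ν μ : Cell}
    (h : ∀ s, Φ (endOf (wayOf C ν.piece (ν.ray s))) = endOf (wayOf C μ.piece (μ.ray s))) :
    IsDecomposable Φ ν :=
  ⟨Unit, inferInstance, fun _ => ν, fun _ => μ, fun _ => subset_rfl,
    fun _ hx => ⟨(), hx, fun _ _ => rfl⟩, fun _ => h⟩

theorem IsDecomposable.of_rest_of_child {ν : Cell} (h1 : IsDecomposable Φ ν.rest)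
    (h2 : IsDecomposable Φ ν.child) : IsDecomposable Φ ν := by
  obtain ⟨ι, _, c, d, hc, hc', hΦ⟩ := h1
  obtain ⟨κ, _, e, f, he, he', hΦ'⟩ := h2
  refine ⟨ι ⊕ κ, inferInstance, Sum.elim c e, Sum.elim d f, ?_, fun x hx => ?_, ?_⟩
  · rintro (i | i)
    · exact (hc i).trans ν.ends_rest_subset
    · exact (he i).trans ν.ends_child_subset
  · rcases ν.ends_subset_union hx with hx' | hx'
    · obtain ⟨i, hi, hi'⟩ := hc' x hx'
      refine ⟨Sum.inl i, hi, ?_⟩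
      rintro (j | j) hj
      · exact congrArg Sum.inl (hi' j hj)
      · exact absurd (he j hj) (Set.disjoint_left.1 ν.ends_disjoint hx')
    · obtain ⟨i, hi, hi'⟩ := he' x hx'
      refine ⟨Sum.inr i, hi, ?_⟩
      rintro (j | j) hj
      · exact absurd hx' (Set.disjoint_left.1 ν.ends_disjoint (hc j hj))
      · exact congrArg Sum.inr (hi' j hj)
  · rintro (i | i)
    · exact hΦ i
    · exact hΦ' i

theorem mem_Hier_of_isDecomposable (hC : C.IsTree) (h : ∀ ν, IsDecomposable Φ ν) :
    Φ ∈ Hier (tree C) := by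
  -- The four cells with empty word and shift `0` are the full copies and exhaust all ends.
  choose ι hι c d hc hc' hΦ using fun p => h ⟨p, [], 0⟩
  have hends : ∀ p s, ((p, s) : Piece × (ℕ → ℕ+)) ∈ (Cell.mk p [] 0).ends := fun p s =>
    ⟨rfl, s, by funext n; cases n <;> rfl⟩
  refine mem_Hier_of_isPartition hC (c := fun i : Σ p, ι p => c i.1 i.2)
    (d := fun i => d i.1 i.2) (fun p s => ?_) fun i => hΦ i.1 i.2
  obtain ⟨i, hi, hi'⟩ := hc' p (p, s) (hends p s)
  refine ⟨⟨p, i⟩, hi, ?_⟩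
  rintro ⟨q, j⟩ hj
  obtain rfl : q = p := (hc q j (show (p, s) ∈ _ from hj)).1
  rw [hi' j hj]

/-- A property of cells which can be checked on the two parts of a cell holds for all cells if it
holds for the cells which avoid a given finite set of rational numbers. -/
theorem Cell.induction_avoiding {P : Cell → Prop} (hP : ∀ ν : Cell, P ν.rest → P ν.child → P ν)
    {B : Set ℚ} (hB : B.Finite)
    (h : ∀ ν : Cell, (∀ q ∈ B, ∀ y : ℝ, 0 < y → ν.chart y ≠ q) → P ν) (ν : Cell) : P ν := by
  induction B, hB using Set.Finite.induction_on generalizing ν with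
  | empty => exact h ν (by simp)
  | @insert q B _ _ ih =>
    -- Euclid's algorithm on the parameter `a / b` of `q`: it becomes `(a - b) / b` in `rest` or `(b
    -- - a) / a` in `child`, lowering `a + b`. For `a = b` the cut falls on `q`, and neither part
    -- contains it.
    have key : ∀ (N : ℕ) (ν : Cell), (∀ q ∈ B, ∀ y : ℝ, 0 < y → ν.chart y ≠ q) →
        (∃ a b : ℕ, 0 < a ∧ 0 < b ∧ a + b ≤ N ∧ ν.chart (a / b) = q) → P ν := by
      intro N
      induction N with
      | zero =>
        rintro ν - ⟨a, b, ha, hb, hN, -⟩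
        omega
      | succ N ihN =>
        rintro ν hν ⟨a, b, ha, hb, hN, hq⟩
        have ha' : (0 : ℝ) < a := by exact_mod_cast ha
        have hb' : (0 : ℝ) < b := by exact_mod_cast hb
        have hν1 : ∀ q ∈ B, ∀ y : ℝ, 0 < y → ν.rest.chart y ≠ q := fun q hq y hy => by
          rw [chart_rest]
          exact hν q hq _ (by positivity)
        have hν2 : ∀ q ∈ B, ∀ y : ℝ, 0 < y → ν.child.chart y ≠ q := fun q hq y hy => by
          rw [chart_child]
          exact hν q hq _ (by positivity)
        refine hP ν ?_ ?_
        · by_cases hex : ∃ y : ℝ, 0 < y ∧ ν.rest.chart y = q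
          · obtain ⟨y, hy, hyq⟩ := hex
            rw [chart_rest, ← hq] at hyq
            have hy' := ν.chart_injective hyq
            rw [eq_div_iff hb'.ne'] at hy'
            have hlt : b < a := by
              have : (b : ℝ) < a := by nlinarith
              exact_mod_cast this
            refine ihN _ hν1 ⟨a - b, b, by omega, hb, by omega, ?_⟩
            rw [chart_rest, ← hq, Nat.cast_sub hlt.le]
            congr 1
            field_simp
            ring
          · push Not at hex
            refine h _ fun r hr y hy => ?_
            rcases Set.mem_insert_iff.1 hr with rfl | hr
            exacts [hex y hy, hν1 r hr y hy]
        · by_cases hex : ∃ y : ℝ, 0 < y ∧ ν.child.chart y = q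
          · obtain ⟨y, hy, hyq⟩ := hex
            rw [chart_child, ← hq] at hyq
            have hy' := inv_eq_iff_eq_inv.1 (ν.chart_injective hyq)
            rw [inv_div, eq_div_iff ha'.ne'] at hy'
            have hlt : a < b := by
              have : (a : ℝ) < b := by nlinarith
              exact_mod_cast this
            refine ihN _ hν2 ⟨b - a, a, by omega, ha, by omega, ?_⟩
            rw [chart_child, ← hq, Nat.cast_sub hlt.le, sub_div, div_self ha'.ne', sub_add_cancel,
              inv_div]
          · push Not at hex
            refine h _ fun r hr y hy => ?_
            rcases Set.mem_insert_iff.1 hr with rfl | hr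
            exacts [hex y hy, hν2 r hr y hy]
    refine ih (fun ν hν => ?_) ν
    by_cases hex : ∃ y : ℝ, 0 < y ∧ ν.chart y = q
    · obtain ⟨y, hy, hyq⟩ := hex
      have hrat : ¬ Irrational y := fun hi => by
        rw [← ν.chart_irrational, hyq] at hi
        exact q.not_irrational hi
      obtain ⟨r, rfl⟩ : y ∈ Set.range ((↑) : ℚ → ℝ) := not_not.1 hrat
      have hr : 0 < r := by exact_mod_cast hy
      refine key _ ν hν ⟨r.num.toNat, r.den, ?_, r.den_pos, le_rfl, ?_⟩
      · have := Rat.num_pos.2 hr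
        omega
      · rw [← hyq]
        congr 1
        have : ((r.num.toNat : ℕ) : ℝ) = (r.num : ℝ) := by
          rw [← Int.cast_natCast, Int.toNat_of_nonneg (Rat.num_nonneg.2 hr.le)]
        rw [this, ← Rat.cast_def]
    · push Not at hex
      refine h _ fun r hr y hy => ?_
      rcases Set.mem_insert_iff.1 hr with rfl | hr
      exacts [hex y hy, hν r hr y hy]

/-! ### Piecewise projective transformations -/

theorem linFrac_irrational (γ : GL (Fin 2) ℤ) {x : ℝ} (hx : Irrational x) :
    ∃ y : ℝ, Irrational y ∧ linFrac γ x = y := by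
  have hdet := det_eq_one_or γ
  set a := γ 0 0
  set b := γ 0 1
  set c := γ 1 0
  set d := γ 1 1
  have hne : (c : ℝ) * x + d ≠ 0 := by
    intro h0
    by_cases hc : c = 0
    · have hd : d = 0 := by
        rw [hc] at h0
        simpa using h0
      simp [hc, hd] at hdet
    · have := (hx.intCast_mul hc).add_intCast d
      exact this.ne_zero h0
  refine ⟨(a * x + b) / (c * x + d), ?_, by rw [linFrac_coe, if_neg hne]⟩
  rintro ⟨q, hq⟩
  rw [eq_div_iff hne] at hq
  have h1 : ((q * c - a : ℚ) : ℝ) * x + ((q * d - b : ℚ) : ℝ) = 0 := by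
    push_cast
    linarith
  by_cases h2 : q * c - a = 0
  · have h3 : q * d - b = 0 := by
      rw [h2, Rat.cast_zero, zero_mul, zero_add] at h1
      exact_mod_cast h1
    have h4 : (a * d - b * c : ℚ) = 0 := by
      have e1 : (a : ℚ) = q * c := by linarith
      have e2 : (b : ℚ) = q * d := by linarith
      rw [e1, e2]
      ring
    have h5 : a * d - b * c = 0 := by exact_mod_cast h4
    omega
  · exact ((hx.ratCast_mul h2).add_ratCast _).ne_zero h1

/-- The value of `(a x + b) / (c x + d)` at a rational point is rational or infinite. -/
theorem not_irrational_of_mul_add_eq {a b c d : ℤ} (hdet : a * d - b * c = 1 ∨ a * d - b * c = -1)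
    (q : ℚ) {y : ℝ} (h : (a : ℝ) * q + b = y * (c * q + d)) : ¬ Irrational y := by
  intro hy
  -- A nonzero factor would make `y` rational; if it vanishes, then so does `a q + b`, and the
  -- determinant is `0`.
  have h1 : (c : ℚ) * q + d = 0 := by
    by_contra h1
    have h2 := hy.mul_ratCast h1
    have h3 : y * ((c * q + d : ℚ) : ℝ) = ((a * q + b : ℚ) : ℝ) := by
      push_cast
      exact h.symm
    rw [h3] at h2
    exact Rat.not_irrational _ h2
  have h2 : (c : ℝ) * q + d = 0 := by exact_mod_cast h1
  rw [h2, mul_zero] at h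
  have h3 : (a : ℚ) * q + b = 0 := by exact_mod_cast h
  have h4 : (a * d - b * c : ℚ) = 0 := by
    have e1 : (b : ℚ) = -(a * q) := by linarith
    have e2 : (d : ℚ) = -(c * q) := by linarith
    rw [e1, e2]
    ring
  have h5 : a * d - b * c = 0 := by exact_mod_cast h4
  omega

theorem not_irrational_of_linFrac_eq (γ : GL (Fin 2) ℤ) {z : OnePoint ℝ}
    (hz : z = OnePoint.infty ∨ ∃ q : ℚ, z = ((q : ℝ) : OnePoint ℝ)) {y : ℝ}
    (h : linFrac γ z = y) : ¬ Irrational y := by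
  rcases hz with rfl | ⟨q, rfl⟩
  · rw [linFrac_infty] at h
    split_ifs at h with hc
    · exact absurd h (OnePoint.infty_ne_coe y)
    · rw [← OnePoint.coe_injective h]
      have : ((γ 0 0 : ℝ) / (γ 1 0 : ℝ)) = ((γ 0 0 / γ 1 0 : ℚ) : ℝ) := by push_cast; rfl
      rw [this]
      exact Rat.not_irrational _
  · rw [linFrac_coe] at h
    split_ifs at h with hc
    · exact absurd h (OnePoint.infty_ne_coe y)
    · have h' := OnePoint.coe_injective h
      rw [div_eq_iff hc] at h'
      exact not_irrational_of_mul_add_eq (det_eq_one_or γ) q h'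

theorem eq_infty_or_rat_or_irrational (z : OnePoint ℝ) :
    (z = OnePoint.infty ∨ ∃ q : ℚ, z = ((q : ℝ) : OnePoint ℝ)) ∨
      ∃ x : ℝ, Irrational x ∧ z = x := by
  induction z using OnePoint.rec with
  | infty => exact Or.inl (Or.inl rfl)
  | coe x =>
    by_cases hx : Irrational x
    · exact Or.inr ⟨x, hx, rfl⟩
    · obtain ⟨q, rfl⟩ : x ∈ Set.range ((↑) : ℚ → ℝ) := not_not.1 hx
      exact Or.inl (Or.inr ⟨q, rfl⟩)

/-- A permutation of the irrational numbers which is piecewise in `PGL₂(ℤ)`, with finitely many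
break points, acts on the boundary of the tree as a spheromorphism. -/
theorem conj_mem_Hier {C : SimpleGraph Piece} (hC : C.IsTree)
    {Ξ : {x : ℝ // Irrational x} ≃ Boundary (tree C)} (hΞ : ∀ x, Ξ x = Xi C x)
    {h : OnePoint ℝ → OnePoint ℝ} (hinj : Function.Injective h) {B : Set ℚ} (hB : B.Finite)
    (hloc : ∀ I : Set ℝ, IsPreconnected I → (∀ q ∈ B, (q : ℝ) ∉ I) →
      ∃ γ : GL (Fin 2) ℤ, ∀ x ∈ I, h (x : ℝ) = linFrac γ x)
    {κ : Equiv.Perm {x : ℝ // Irrational x}}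
    (hκ : ∀ x, ((κ x : ℝ) : OnePoint ℝ) = h ((x : ℝ) : OnePoint ℝ)) :
    (Ξ.symm.trans κ).trans Ξ ∈ Hier (tree C) := by
  have hstd : ∀ ν μ : Cell, (∀ y : ℝ, 0 < y → h (ν.chart y) = μ.chart y) →
      IsDecomposable ((Ξ.symm.trans κ).trans Ξ) ν := by
    intro ν μ hνμ
    refine IsDecomposable.of_ray (μ := μ) fun s => ?_
    obtain ⟨t, hti, ht, rfl⟩ := exists_partialQuotient_eq s
    have hy : 0 < t - 1 := by linarith
    have hyi : Irrational (t - 1) := by simpa using hti.sub_natCast 1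
    have hν := ν.chart_irrational.2 hyi
    have hμ := μ.chart_irrational.2 hyi
    have e1 := ν.Xi_chart C hy hν
    have e2 := μ.Xi_chart C hy hμ
    rw [sub_add_cancel, ← hΞ] at e1 e2
    have e3 : κ ⟨_, hν⟩ = ⟨_, hμ⟩ :=
      Subtype.ext (OnePoint.coe_injective ((hκ ⟨_, hν⟩).trans (hνμ _ hy)))
    rw [← e1, ← e2, Equiv.trans_apply, Equiv.trans_apply, Equiv.symm_apply_apply, e3]
  have hinjQ : Function.Injective fun q : ℚ => h ((q : ℝ) : OnePoint ℝ) := fun p q hpq => by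
    exact_mod_cast OnePoint.coe_injective (hinj hpq)
  -- These are the end points of the pieces. Removing their rational preimages as well confines the
  -- image of each cell to one piece, and irrational points never map to them.
  let E : Set (OnePoint ℝ) := {OnePoint.infty, ((0 : ℝ) : OnePoint ℝ), ((1 : ℝ) : OnePoint ℝ),
    ((-1 : ℝ) : OnePoint ℝ)}
  have hE : E.Finite := Set.toFinite _
  have hE' : ∀ e ∈ E, ¬ ∃ y : ℝ, Irrational y ∧ e = y := by
    rintro e (rfl | rfl | rfl | rfl) ⟨y, hy, h⟩
    · exact OnePoint.infty_ne_coe y h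
    · exact hy.ne_zero (OnePoint.coe_injective h).symm
    · exact hy.ne_one (OnePoint.coe_injective h).symm
    · exact hy.ne_int (-1) (by simpa using (OnePoint.coe_injective h).symm)
  refine mem_Hier_of_isDecomposable hC (Cell.induction_avoiding
    (fun ν => IsDecomposable.of_rest_of_child)
    (hB.union (hE.preimage hinjQ.injOn)) fun ν hν => ?_)
  obtain ⟨γ, hγ⟩ := hloc (ν.chart '' Set.Ioi 0) (isPreconnected_Ioi.image _ ν.continuousOn_chart)
    (by
      rintro q hq ⟨y, hy, hyq⟩
      exact hν q (Or.inl hq) y hy hyq)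
  have hγ' : ∀ y : ℝ, 0 < y → h (ν.chart y) = linFrac γ (ν.chart y) := fun y hy =>
    hγ _ ⟨y, hy, rfl⟩
  have hmem : ∀ y : ℝ, 0 < y → linFrac γ (ν.chart y) ∉ E := by
    intro y hy hmem
    by_cases hi : Irrational (ν.chart y)
    · exact hE' _ hmem (linFrac_irrational γ hi)
    · obtain ⟨q, hq⟩ : ν.chart y ∈ Set.range ((↑) : ℚ → ℝ) := not_not.1 hi
      refine hν q (Or.inr ?_) y hy hq.symm
      rw [Set.mem_preimage, hq, hγ' y hy]
      exact hmem
  obtain ⟨μ, hμ | hμ⟩ := ν.exists_linFrac_chart_eq γ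
    (fun y hy he => hmem y hy (by simp [E, he])) (fun y hy he => hmem y hy (by simp [E, he]))
    (fun y hy he => hmem y hy (by simp [E, he])) (fun y hy he => hmem y hy (by simp [E, he]))
  · exact hstd ν μ fun y hy => (hγ' y hy).trans (hμ y hy)
  -- In the inverted case `y ↦ y⁻¹` exchanges the two halves: `rest` goes to `child` and `child` to
  -- `rest`, each with its parameter preserved.
  · refine IsDecomposable.of_rest_of_child (hstd _ μ.child fun y hy => ?_)
      (hstd _ μ.rest fun y hy => ?_)
    · rw [Cell.chart_rest, Cell.chart_child, hγ' _ (by positivity), hμ _ (by positivity)]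
    · rw [Cell.chart_child, Cell.chart_rest, hγ' _ (by positivity), hμ _ (by positivity), inv_inv]

/-- A permutation of the projective line which preserves the set of irrational numbers restricts
to a permutation of this set. -/
theorem exists_perm_irrational (h : Equiv.Perm (OnePoint ℝ))
    (h1 : ∀ x : ℝ, Irrational x → ∃ y : ℝ, Irrational y ∧ h x = y)
    (h2 : ∀ z, (z = OnePoint.infty ∨ ∃ q : ℚ, z = ((q : ℝ) : OnePoint ℝ)) →
      ∀ y : ℝ, h z = y → ¬ Irrational y) :
    ∃ κ : Equiv.Perm {x : ℝ // Irrational x},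
      ∀ x, ((κ x : ℝ) : OnePoint ℝ) = h ((x : ℝ) : OnePoint ℝ) := by
  choose f hf hf' using h1
  refine ⟨Equiv.ofBijective (fun x => ⟨f x x.2, hf x x.2⟩) ⟨fun x y hxy => ?_, fun y => ?_⟩,
    fun x => (hf' x x.2).symm⟩
  · have : h (x : ℝ) = h (y : ℝ) := by
      rw [hf' x x.2, hf' y y.2, show f x x.2 = f y y.2 from congrArg Subtype.val hxy]
    exact Subtype.ext (OnePoint.coe_injective (h.injective this))
  · rcases eq_infty_or_rat_or_irrational (h.symm (y : ℝ)) with hz | ⟨x, hx, hz⟩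
    · exact absurd y.2 (h2 _ hz y (h.apply_symm_apply _))
    · refine ⟨⟨x, hx⟩, Subtype.ext (OnePoint.coe_injective ?_)⟩
      rw [← hf' x hx, ← hz, h.apply_symm_apply]

open Filter Topology in
/-- Along a filter on the line, if `(a x + b) / (c x + d)` has a finite limit in the projective
line, then it converges to this limit as a real function. -/
theorem exists_tendsto_of_linFrac {l : Filter ℝ} (γ : GL (Fin 2) ℤ) {h : OnePoint ℝ → OnePoint ℝ}
    (hγ : ∀ᶠ x : ℝ in l, h x = linFrac γ x) {y : ℝ}
    (hy : Tendsto (fun x : ℝ => h x) l (𝓝 (y : OnePoint ℝ))) :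
    ∃ g : ℝ → ℝ, Tendsto g l (𝓝 y) ∧
      ∀ᶠ x : ℝ in l, γ 0 0 * x + γ 0 1 = g x * (γ 1 0 * x + γ 1 1) := by
  refine ⟨fun x => (γ 0 0 * x + γ 0 1) / (γ 1 0 * x + γ 1 1), ?_, ?_⟩
  all_goals
    have hne : ∀ᶠ x : ℝ in l, h x ≠ OnePoint.infty :=
      hy.eventually (isOpen_ne.mem_nhds (OnePoint.coe_ne_infty y))
  · rw [OnePoint.isOpenEmbedding_coe.isEmbedding.tendsto_nhds_iff]
    refine hy.congr' ?_
    filter_upwards [hγ, hne] with x hx hx'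
    rw [hx, linFrac_coe] at hx'
    rw [hx, linFrac_coe]
    split_ifs at hx' ⊢ with hc
    · exact absurd rfl hx'
    · rfl
  · filter_upwards [hγ, hne] with x hx hx'
    rw [hx, linFrac_coe] at hx'
    split_ifs at hx' with hc
    · exact absurd rfl hx'
    · rw [div_mul_cancel₀ _ hc]

open Filter Topology in
/-- The elements of the Thompson group map rational points to rational points. -/
theorem not_irrational_of_thompson {h : OnePoint ℝ ≃ₜ OnePoint ℝ} (hh : h ∈ thompson)
    {z : OnePoint ℝ} (hz : z = OnePoint.infty ∨ ∃ q : ℚ, z = ((q : ℝ) : OnePoint ℝ)) {y : ℝ}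
    (hy : h z = y) : ¬ Irrational y := by
  obtain ⟨F, hF, -, hloc⟩ := hh
  have hF' : {x : ℝ | (x : OnePoint ℝ) ∈ F}.Finite := hF.preimage OnePoint.coe_injective.injOn
  have hlocI : ∀ I : Set ℝ, IsPreconnected I → (∀ x ∈ I, (x : OnePoint ℝ) ∉ F) →
      ∃ γ : GL (Fin 2) ℤ, ∀ x ∈ I, h (x : ℝ) = linFrac γ x := by
    intro I hI hd
    obtain ⟨γ, hγ⟩ := hloc ((↑) '' I) (hI.image _ OnePoint.continuous_coe.continuousOn)
      (Set.disjoint_left.2 (by rintro _ ⟨x, hx, rfl⟩; exact hd x hx))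
    exact ⟨γ, fun x hx => hγ x ⟨x, hx, rfl⟩⟩
  -- The point may be a break point, so its image is computed as a limit along an interval to its
  -- right (towards `+∞` for the point at infinity), where a single `γ` applies.
  rcases hz with rfl | ⟨q, rfl⟩
  · obtain ⟨M, hM⟩ := hF'.bddAbove
    obtain ⟨γ, hγ⟩ := hlocI (Set.Ioi M) isPreconnected_Ioi fun x hx hxF =>
      absurd (hM hxF) (not_le.2 hx)
    have ht : Tendsto (fun x : ℝ => (x : OnePoint ℝ)) atTop (𝓝 OnePoint.infty) := by
      refine OnePoint.tendsto_coe_infty.mono_left ?_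
      rw [coclosedCompact_eq_cocompact]
      exact atTop_le_cocompact
    obtain ⟨g, hg, hg'⟩ := exists_tendsto_of_linFrac γ
      ((eventually_gt_atTop M).mono fun x hx => hγ x hx)
      (hy ▸ (h.continuous.tendsto OnePoint.infty).comp ht)
    have hinv : Tendsto (fun x : ℝ => x⁻¹) atTop (𝓝 0) := tendsto_inv_atTop_zero
    have h1 : Tendsto (fun x : ℝ => (γ 0 0 : ℝ) + γ 0 1 * x⁻¹) atTop (𝓝 (γ 0 0 + γ 0 1 * 0)) :=
      tendsto_const_nhds.add (tendsto_const_nhds.mul hinv)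
    have h2 : Tendsto (fun x : ℝ => g x * ((γ 1 0 : ℝ) + γ 1 1 * x⁻¹)) atTop
        (𝓝 (y * (γ 1 0 + γ 1 1 * 0))) :=
      hg.mul (tendsto_const_nhds.add (tendsto_const_nhds.mul hinv))
    have h3 := tendsto_nhds_unique (h2.congr' (by
      filter_upwards [hg', eventually_gt_atTop 0] with x hx hx0
      field_simp
      linarith)) h1
    -- After division by `x` the limit is taken at `x⁻¹ = 0`, which exchanges the columns of the
    -- matrix.
    refine not_irrational_of_mul_add_eq (a := γ 0 1) (b := γ 0 0) (c := γ 1 1) (d := γ 1 0)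
      ?_ 0 (y := y) ?_
    · rcases det_eq_one_or γ with h | h
      · right; linarith
      · left; linarith
    · push_cast
      linarith
  -- The point `q` itself is taken out of the excluded set, since it may belong to `F`.
  · have hev : ∀ᶠ x in 𝓝[>] (q : ℝ), x ∉ {x : ℝ | (x : OnePoint ℝ) ∈ F} \ {(q : ℝ)} :=
      nhdsWithin_le_nhds ((hF'.subset Set.sdiff_subset).isClosed.isOpen_compl.mem_nhds (by simp))
    obtain ⟨u, hu, hu'⟩ := (mem_nhdsGT_iff_exists_Ioo_subset).1 hev
    obtain ⟨γ, hγ⟩ := hlocI (Set.Ioo q u) isPreconnected_Ioo fun x hx hxF =>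
      hu' hx ⟨hxF, hx.1.ne'⟩
    have ht : Tendsto (fun x : ℝ => (x : OnePoint ℝ)) (𝓝[>] (q : ℝ)) (𝓝 ((q : ℝ) : OnePoint ℝ)) :=
      (OnePoint.continuous_coe.tendsto _).mono_left nhdsWithin_le_nhds
    obtain ⟨g, hg, hg'⟩ := exists_tendsto_of_linFrac γ
      (Filter.mem_of_superset (Ioo_mem_nhdsGT hu) fun x hx => hγ x hx)
      (hy ▸ (h.continuous.tendsto _).comp ht)
    have hid : Tendsto (fun x : ℝ => x) (𝓝[>] (q : ℝ)) (𝓝 q) := nhdsWithin_le_nhds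
    have h1 : Tendsto (fun x : ℝ => (γ 0 0 : ℝ) * x + γ 0 1) (𝓝[>] (q : ℝ))
        (𝓝 (γ 0 0 * q + γ 0 1)) := (tendsto_const_nhds.mul hid).add tendsto_const_nhds
    have h2 : Tendsto (fun x : ℝ => g x * (γ 1 0 * x + γ 1 1)) (𝓝[>] (q : ℝ))
        (𝓝 (y * (γ 1 0 * q + γ 1 1))) :=
      hg.mul ((tendsto_const_nhds.mul hid).add tendsto_const_nhds)
    exact not_irrational_of_mul_add_eq (det_eq_one_or γ) q
      (tendsto_nhds_unique (h1.congr' hg') h2)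

end Spheromorphism

theorem theorem3p2 (C : SimpleGraph Spheromorphism.Piece) (hC : C.IsTree) :
    ∃ Ξ : {x : ℝ // Irrational x} ≃ Spheromorphism.Boundary (Spheromorphism.tree C),
      (∀ x, Ξ x = Spheromorphism.Xi C x) ∧
      (∀ h ∈ Spheromorphism.thompson,
        ∃ κ : Equiv.Perm {x : ℝ // Irrational x},
          (∀ x, (((κ x : ℝ)) : OnePoint ℝ) = h ((x : ℝ) : OnePoint ℝ)) ∧
          (Ξ.symm.trans κ).trans Ξ ∈ Spheromorphism.Hier (Spheromorphism.tree C)) ∧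
      (∀ γ : GL (Fin 2) ℤ,
        ∃ κ : Equiv.Perm {x : ℝ // Irrational x},
          (∀ x, (((κ x : ℝ)) : OnePoint ℝ) =
            Spheromorphism.linFrac γ ((x : ℝ) : OnePoint ℝ)) ∧
          (Ξ.symm.trans κ).trans Ξ ∈ Spheromorphism.Hier (Spheromorphism.tree C)) := by
  open Spheromorphism in
  refine ⟨Equiv.ofBijective _ (Xi_bijective C), fun x => rfl, fun h hh => ?_, fun γ => ?_⟩
  · obtain ⟨F, hF, hFrat, hloc⟩ := id hh
    have h1 : ∀ x : ℝ, Irrational x → ∃ y : ℝ, Irrational y ∧ h x = y := by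
      intro x hx
      -- A singleton is connected and an irrational point lies outside `F`, so the definition
      -- applies to it directly.
      obtain ⟨γ, hγ⟩ := hloc {(x : OnePoint ℝ)} isPreconnected_singleton
        (Set.disjoint_singleton_left.2 fun hxF => by
          rcases hFrat _ hxF with h | ⟨q, h⟩
          · exact OnePoint.coe_ne_infty x h
          · exact hx ⟨q, (OnePoint.coe_injective h).symm⟩)
      rw [hγ x rfl]
      exact linFrac_irrational _ hx
    obtain ⟨κ, hκ⟩ := exists_perm_irrational h.toEquiv h1
      fun z hz y hy => not_irrational_of_thompson hh hz hy
    refine ⟨κ, hκ, conj_mem_Hier hC (fun x => rfl) h.injective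
      (B := {q : ℚ | ((q : ℝ) : OnePoint ℝ) ∈ F})
      (hF.preimage (OnePoint.coe_injective.comp Rat.cast_injective).injOn)
      (fun I hI hd => ?_) hκ⟩
    obtain ⟨γ, hγ⟩ := hloc ((↑) '' I) (hI.image _ OnePoint.continuous_coe.continuousOn)
      (Set.disjoint_left.2 (by
        rintro _ ⟨x, hx, rfl⟩ hxF
        rcases hFrat _ hxF with h | ⟨q, h⟩
        · exact OnePoint.coe_ne_infty x h
        · rw [OnePoint.coe_injective h] at hx hxF
          exact hd q hxF hx))
    exact ⟨γ, fun x hx => hγ x ⟨x, hx, rfl⟩⟩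
  · let h : Equiv.Perm (OnePoint ℝ) := MulAction.toPerm (γ.map (Int.castRingHom ℝ))
    have hh : ∀ z, h z = linFrac γ z := fun _ => rfl
    obtain ⟨κ, hκ⟩ := exists_perm_irrational h
      (fun x hx => linFrac_irrational γ hx) fun z hz y hy => not_irrational_of_linFrac_eq γ hz hy
    exact ⟨κ, hκ, conj_mem_Hier hC (fun x => rfl) h.injective Set.finite_empty
      (fun I _ _ => ⟨γ, fun x _ => hh x⟩) hκ⟩
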